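/- Let $L$ be a field, let $A$ be a central simple $L$-algebra with $\dim_L A=n^2$, endowed with an involution $\tau$ (an anti-automorphism of the ring $A$ with $\tau^2=\mathrm{id}$), and let $K=L^{\tau}$. Let $E$ be a commutative étale $L$-algebra with $\dim_L E=n$, endowed with a ring automorphism $\sigma$ such that $\sigma^2=\mathrm{id}$ and $\sigma|_L=\tau|_L$, and let $F=E^{\sigma}$. Assume that either $\tau|_L\neq\mathrm{id}_L$, or $\tau|_L=\mathrm{id}_L$ (so $K=L$), $\operatorname{char}L\neq 2$, $n$ is even and $\dim_K F=n/2$. Let $T=\mathrm U(E,\sigma)$ and $H=\mathrm U(A,\tau)$ be the unitary groups, regarded as algebraic $K$-groups: for a commutative $K$-algebra $R$, $H(R)=\{x\in(A\otimes_K R)^\times : \tau(x)x=1\}$ and $T(R)=\{x\in(E\otimes_K R)^\times : \sigma(x)x=1\}$, where $\tau,\sigma$ also denote the natural extensions. Let $K_{sep}$ be a separable closure of $K$. For $G = T, H$ let $Z^1(K,G)$ be the set of continuous $1$-cocycles of $\mathrm{Gal}(K_{sep}/K)$ with values in the discrete group $G(K_{sep})$, and let $H^1(K,G)$ be its quotient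 by the relation $\xi\sim\xi'$ if $\xi'_\theta=t\,\xi_\theta\,\theta(t)^{-1}$ for some $t\in G(K_{sep})$ and all $\theta$. Let $\varepsilon\colon E\hookrightarrow A$ be an $L$-embedding of algebras, which need not respect the involutions; its extension $E\otimes_K K_{sep}\to A\otimes_K K_{sep}$ is also denoted by $\varepsilon$. Let $g\in A^\times$ be such that $\tau(g)=g$ and $\varepsilon(\sigma(x))=g^{-1}\tau(\varepsilon(x))g$ for all $x\in E$, and let $s\in(A\otimes_K K_{sep})^\times$ be such that $g=\tau(s)s$. (i) Given $\xi=\{\xi_\theta\}\in Z^1(K,T)$, set $\zeta_\theta=s\,\varepsilon(\xi_\theta)\,\theta(s)^{-1}$. Then $\zeta=\{\zeta_\theta\}\in Z^1(K,H)$, and the correspondence $\xi\mapsto\zeta$ yields a well-defined map $\varphi\colon H^1(K,T)\to H^1(K,H)$. (ii) The equation $g\varepsilon(b)=\tau(h)h$ has a solution $(b,h)\in F^\times\times A^\times$ if and only if the image of $\varphi$ contains the trivial element of $H^1(K,H)$. Moreover, this equation has a solution if and only if there is an $L$-embedding $\iota\colon E\hookrightarrow A$ with $\iota\circ\sigma=\tau\circ\iota$.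 -/

import Mathlib

open scoped TensorProduct

/-- An involution of a `K`-algebra `B`: a `K`-linear anti-automorphism of `B` whose square is the
identity.  If `B` is commutative, this is an automorphism of `B` with square the identity. -/
structure AlgInvolution (K B : Type*) [CommSemiring K] [Semiring B] [Algebra K B]
    extends B →ₗ[K] B where
  map_mul_rev' : ∀ x y : B, toFun (x * y) = toFun y * toFun x
  involutive' : ∀ x : B, toFun (toFun x) = x

namespace AlgInvolution

section Basic

variable {K B : Type*} [CommSemiring K] [Semiring B] [Algebra K B]

instance : CoeFun (AlgInvolution K B) (fun _ => B → B) := ⟨fun τ => τ.toLinearMap⟩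

theorem map_mul_rev (τ : AlgInvolution K B) (x y : B) : τ (x * y) = τ y * τ x :=
  τ.map_mul_rev' x y

theorem apply_apply (τ : AlgInvolution K B) (x : B) : τ (τ x) = x := τ.involutive' x

theorem map_one (τ : AlgInvolution K B) : τ (1 : B) = 1 := by
  have h := τ.map_mul_rev (τ 1) 1
  rw [mul_one, τ.apply_apply, mul_one] at h
  exact h.symm

theorem map_algebraMap (τ : AlgInvolution K B) (k : K) :
    τ (algebraMap K B k) = algebraMap K B k := by
  rw [Algebra.algebraMap_eq_smul_one, map_smul τ.toLinearMap, τ.map_one]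

end Basic

/-- The subalgebra of elements fixed by an involution of a commutative algebra. -/
def fixedSubalgebra {K B : Type*} [CommSemiring K] [CommSemiring B] [Algebra K B]
    (σ : AlgInvolution K B) : Subalgebra K B where
  carrier := {x | σ x = x}
  mul_mem' := by
    intro x y hx hy
    have hx' : σ x = x := hx
    have hy' : σ y = y := hy
    change σ (x * y) = x * y
    rw [σ.map_mul_rev, hx', hy', mul_comm]
  add_mem' := by
    intro x y hx hy
    have hx' : σ x = x := hx
    have hy' : σ y = y := hy
    change σ (x + y) = x + y
    rw [map_add σ.toLinearMap, hx', hy']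
  algebraMap_mem' := fun k => σ.map_algebraMap k

section BaseChange

variable {K B : Type*} [CommRing K] [Ring B] [Algebra K B]

/-- The natural extension `τ ⊗ id_R` of an involution `τ` of `B` to `B ⊗[K] R`. -/
def baseChange (τ : AlgInvolution K B) (R : Type*) [CommRing R] [Algebra K R] :
    AlgInvolution K (B ⊗[K] R) where
  toLinearMap := LinearMap.rTensor R τ.toLinearMap
  map_mul_rev' := by
    intro x y
    change LinearMap.rTensor R τ.toLinearMap (x * y) =
      LinearMap.rTensor R τ.toLinearMap y * LinearMap.rTensor R τ.toLinearMap x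
    induction x with
    | zero => simp
    | add x₁ x₂ h₁ h₂ => rw [add_mul, map_add, h₁, h₂, map_add, mul_add]
    | tmul a r =>
      induction y with
      | zero => simp
      | add y₁ y₂ h₁ h₂ => rw [mul_add, map_add, h₁, h₂, map_add, add_mul]
      | tmul b t =>
        rw [Algebra.TensorProduct.tmul_mul_tmul, LinearMap.rTensor_tmul, LinearMap.rTensor_tmul,
          LinearMap.rTensor_tmul, Algebra.TensorProduct.tmul_mul_tmul, mul_comm r t]
        exact congrArg (fun z => z ⊗ₜ[K] (t * r)) (τ.map_mul_rev a b)
  involutive' := by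
    intro x
    change LinearMap.rTensor R τ.toLinearMap (LinearMap.rTensor R τ.toLinearMap x) = x
    induction x with
    | zero => simp
    | add x₁ x₂ h₁ h₂ => rw [map_add, map_add, h₁, h₂]
    | tmul a r =>
      rw [LinearMap.rTensor_tmul, LinearMap.rTensor_tmul]
      exact congrArg (fun z => z ⊗ₜ[K] r) (τ.apply_apply a)

/-- The group of `R`-points of the unitary group `U(B, τ)`, an algebraic group over `K`: the
elements `x` of `(B ⊗[K] R)ˣ` with `τ(x) x = 1`. -/
def unitaryGroup (τ : AlgInvolution K B) (R : Type*) [CommRing R] [Algebra K R] :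
    Subgroup (B ⊗[K] R)ˣ where
  carrier := {x | τ.baseChange R (x : B ⊗[K] R) * (x : B ⊗[K] R) = 1}
  one_mem' := by
    change τ.baseChange R (1 : B ⊗[K] R) * (1 : B ⊗[K] R) = 1
    rw [map_one, mul_one]
  mul_mem' := by
    intro x y hx hy
    have hx' : τ.baseChange R (x : B ⊗[K] R) * (x : B ⊗[K] R) = 1 := hx
    have hy' : τ.baseChange R (y : B ⊗[K] R) * (y : B ⊗[K] R) = 1 := hy
    change τ.baseChange R ((x : B ⊗[K] R) * (y : B ⊗[K] R)) *
      ((x : B ⊗[K] R) * (y : B ⊗[K] R)) = 1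
    rw [map_mul_rev, mul_assoc, ← mul_assoc _ (x : B ⊗[K] R), hx', one_mul, hy']
  inv_mem' := by
    intro x hx
    have hx' : τ.baseChange R (x : B ⊗[K] R) * (x : B ⊗[K] R) = 1 := hx
    have h1 : τ.baseChange R (x : B ⊗[K] R) = ((x⁻¹ : (B ⊗[K] R)ˣ) : B ⊗[K] R) :=
      Units.eq_inv_of_mul_eq_one_right hx'
    change τ.baseChange R ((x⁻¹ : (B ⊗[K] R)ˣ) : B ⊗[K] R) * ((x⁻¹ : (B ⊗[K] R)ˣ) : B ⊗[K] R) = 1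
    rw [← h1, apply_apply, h1, Units.mul_inv]

end BaseChange

end AlgInvolution

section GaloisAction

variable {K : Type*} [Field K] (B : Type*) [Ring B] [Algebra K B]
  {Ω : Type*} [Field Ω] [Algebra K Ω]

/-- The action of `θ ∈ Gal(Ω/K)` on `(B ⊗[K] Ω)ˣ` through the second factor. -/
def galUnits (θ : Ω ≃ₐ[K] Ω) : (B ⊗[K] Ω)ˣ →* (B ⊗[K] Ω)ˣ :=
  Units.map (Algebra.TensorProduct.map (AlgHom.id K B) (θ : Ω →ₐ[K] Ω) :
    B ⊗[K] Ω →ₐ[K] B ⊗[K] Ω)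

theorem galUnits_one (x : (B ⊗[K] Ω)ˣ) : galUnits B (1 : Ω ≃ₐ[K] Ω) x = x := by
  ext
  change Algebra.TensorProduct.map (AlgHom.id K B) ((1 : Ω ≃ₐ[K] Ω) : Ω →ₐ[K] Ω) (x : B ⊗[K] Ω) = x
  have : ((1 : Ω ≃ₐ[K] Ω) : Ω →ₐ[K] Ω) = AlgHom.id K Ω := rfl
  rw [this, Algebra.TensorProduct.map_id]
  rfl

theorem galUnits_mul (θ₁ θ₂ : Ω ≃ₐ[K] Ω) (x : (B ⊗[K] Ω)ˣ) :
    galUnits B (θ₁ * θ₂) x = galUnits B θ₁ (galUnits B θ₂ x) := by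
  ext
  change Algebra.TensorProduct.map (AlgHom.id K B) ((θ₁ * θ₂ : Ω ≃ₐ[K] Ω) : Ω →ₐ[K] Ω)
      (x : B ⊗[K] Ω) =
    Algebra.TensorProduct.map (AlgHom.id K B) (θ₁ : Ω →ₐ[K] Ω)
      (Algebra.TensorProduct.map (AlgHom.id K B) (θ₂ : Ω →ₐ[K] Ω) (x : B ⊗[K] Ω))
  generalize (x : B ⊗[K] Ω) = z
  induction z with
  | zero => simp
  | add x₁ x₂ h₁ h₂ => rw [map_add, h₁, h₂, map_add, map_add]
  | tmul a r => rfl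

variable {B}

theorem galUnits_mem_unitaryGroup (τ : AlgInvolution K B) (θ : Ω ≃ₐ[K] Ω) {x : (B ⊗[K] Ω)ˣ}
    (hx : x ∈ τ.unitaryGroup Ω) : galUnits B θ x ∈ τ.unitaryGroup Ω := by
  have hx' : τ.baseChange Ω (x : B ⊗[K] Ω) * (x : B ⊗[K] Ω) = 1 := hx
  have hc : ∀ z : B ⊗[K] Ω,
      τ.baseChange Ω (Algebra.TensorProduct.map (AlgHom.id K B) (θ : Ω →ₐ[K] Ω) z) =
        Algebra.TensorProduct.map (AlgHom.id K B) (θ : Ω →ₐ[K] Ω) (τ.baseChange Ω z) := by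
    intro z
    induction z with
    | zero => simp
    | add x₁ x₂ h₁ h₂ => simp only [map_add, h₁, h₂]
    | tmul a r => rfl
  change τ.baseChange Ω (Algebra.TensorProduct.map (AlgHom.id K B) (θ : Ω →ₐ[K] Ω) x) *
    Algebra.TensorProduct.map (AlgHom.id K B) (θ : Ω →ₐ[K] Ω) x = 1
  rw [hc, ← map_mul, hx', _root_.map_one]

/-- The action of `Gal(Ω/K)` on the group of `Ω`-points of `U(B, τ)`. -/
instance unitaryGroupGaloisAction (τ : AlgInvolution K B) :
    MulDistribMulAction (Ω ≃ₐ[K] Ω) (τ.unitaryGroup Ω) where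
  smul θ x := ⟨galUnits B θ x, galUnits_mem_unitaryGroup τ θ x.2⟩
  one_smul x := Subtype.ext (galUnits_one B (x : (B ⊗[K] Ω)ˣ))
  mul_smul θ₁ θ₂ x := Subtype.ext (galUnits_mul B θ₁ θ₂ (x : (B ⊗[K] Ω)ˣ))
  smul_one θ := Subtype.ext (_root_.map_one (galUnits B θ))
  smul_mul θ x y := Subtype.ext (_root_.map_mul (galUnits B θ) (x : (B ⊗[K] Ω)ˣ) y)

end GaloisAction

section NonabelianCohomology

variable (Γ G : Type*) [Group Γ] [TopologicalSpace Γ] [Group G] [MulDistribMulAction Γ G]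

/-- Continuous (that is, locally constant) 1-cocycles of the topological group `Γ` with values in
the discrete, possibly non-commutative, `Γ`-group `G`. -/
structure ContCocycle where
  toFun : Γ → G
  locConst' : IsLocallyConstant toFun
  map_mul' : ∀ θ₁ θ₂ : Γ, toFun (θ₁ * θ₂) = toFun θ₁ * θ₁ • toFun θ₂

instance : CoeFun (ContCocycle Γ G) (fun _ => Γ → G) := ⟨ContCocycle.toFun⟩

/-- The trivial cocycle. -/
def trivialCocycle : ContCocycle Γ G where
  toFun _ := 1
  locConst' := IsLocallyConstant.const 1
  map_mul' θ₁ _ := by rw [smul_one, mul_one]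

/-- Two cocycles `ξ`, `ξ'` are cohomologous if `ξ'_θ = t ξ_θ θ(t)⁻¹` for some `t` in `G`. -/
def cohomologousSetoid : Setoid (ContCocycle Γ G) where
  r ξ ξ' := ∃ t : G, ∀ θ : Γ, ξ' θ = t * ξ θ * (θ • t)⁻¹
  iseqv :=
    { refl := fun ξ => ⟨1, fun θ => by simp⟩
      symm := by
        rintro ξ ξ' ⟨t, ht⟩
        refine ⟨t⁻¹, fun θ => ?_⟩
        rw [ht, smul_inv', inv_inv]
        group
      trans := by
        rintro ξ ξ' ξ'' ⟨t, ht⟩ ⟨u, hu⟩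
        refine ⟨u * t, fun θ => ?_⟩
        rw [hu, ht, smul_mul', mul_inv_rev]
        group }

/-- The first cohomology set `H¹(Γ, G)`. -/
def ContH1 : Type _ := Quotient (cohomologousSetoid Γ G)

variable {Γ G}

/-- The class of a cocycle. -/
def ContCocycle.cls (ξ : ContCocycle Γ G) : ContH1 Γ G := Quotient.mk (cohomologousSetoid Γ G) ξ

variable (Γ G)

/-- The trivial class in `H¹(Γ, G)`. -/
def ContH1.trivialClass : ContH1 Γ G := (trivialCocycle Γ G).cls

end NonabelianCohomology

/-- The first Galois cohomology set `H¹(K, U(B, τ))`, computed with a separable closure `Ω` of `K`: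
the cohomology set of the profinite group `Gal(Ω/K)` with values in the `Ω`-points. -/
abbrev UnitaryH1 {K B : Type*} [Field K] [Ring B] [Algebra K B] (τ : AlgInvolution K B)
    (Ω : Type*) [Field Ω] [Algebra K Ω] : Type _ :=
  ContH1 (Ω ≃ₐ[K] Ω) (τ.unitaryGroup Ω)

/-- The 1-cocycles of `Gal(Ω/K)` with values in the `Ω`-points of `U(B, τ)`. -/
abbrev UnitaryZ1 {K B : Type*} [Field K] [Ring B] [Algebra K B] (τ : AlgInvolution K B)
    (Ω : Type*) [Field Ω] [Algebra K Ω] : Type _ :=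
  ContCocycle (Ω ≃ₐ[K] Ω) (τ.unitaryGroup Ω)

/-- The natural extension of a homomorphism `f : E → A` of `K`-algebras to
`(E ⊗[K] Ω)ˣ → (A ⊗[K] Ω)ˣ`. -/
def unitsBaseChange {K E A : Type*} [Field K] [Ring E] [Algebra K E] [Ring A] [Algebra K A]
    (f : E →ₐ[K] A) (Ω : Type*) [Field Ω] [Algebra K Ω] : (E ⊗[K] Ω)ˣ →* (A ⊗[K] Ω)ˣ :=
  Units.map (Algebra.TensorProduct.map f (AlgHom.id K Ω) : E ⊗[K] Ω →ₐ[K] A ⊗[K] Ω)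

/-! Everything rests on the hermitian square u ↦ τ(u)u. Two units have the same one exactly when
they differ by a unitary factor on the left, and for x in (E ⊗ Ω)ˣ the hermitian square of s ε(x) is
g ε(σ(x)x), because g = τ(s)s and g intertwines ε ∘ σ with τ ∘ ε. For x = ξ_θ unitary this equals g,
which is also the hermitian square of θ(s), so ζ_θ is unitary; replacing ξ by a cohomologous cocycle
through t changes ζ through s ε(t) s⁻¹.

Suppose g ε(b) = τ(h)h. Over the separable closure b = σ(e)e: if σ is nontrivial on L, the scalar
extension contains an idempotent p with σ(p) = 1 - p, and e = pb + σ(p) works; otherwise 2 is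
invertible and b has a σ-fixed square root. Then ξ_θ = e θ(e)⁻¹ is a cocycle in T, and t = s ε(e)
h⁻¹ is unitary and trivializes its twist.

Conversely, if t trivializes the twist of ξ, the coset t⁻¹ s ε((E ⊗ Ω)ˣ) is Galois-stable. A form of
Hilbert 90 finds h in Aˣ inside it, h = t⁻¹ s ε(e). Comparing hermitian squares gives g ε(σ(e)e) =
τ(h)h, so σ(e)e is Galois-fixed and descends to b in Fˣ.

For embeddings, a solution makes x ↦ h ε(x) h⁻¹ respect the involutions. Conversely an involutive ι
is conjugate to ε by some h (Skolem–Noether), g⁻¹ τ(h)h centralizes ε(E), and ε(E) is its own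
centralizer, so this element is ε(b). Since E need not be a field, both facts are proved by
splitting over the algebraic closure. Skolem–Noether and Hilbert 90 share one device,
`exists_isUnit_mem_of_baseChange`: a subspace that acquires a unit generator over E after scalar
extension already contains a unit. -/

/-! ### Subspaces under extension of scalars -/

section TensorSubspace

variable {k M N Ω : Type*} [Field k] [AddCommGroup M] [Module k M] [AddCommGroup N] [Module k N]
  [AddCommGroup Ω] [Module k Ω]

theorem mem_range_rTensor_of_coord_mem {κ : Type*} [DecidableEq κ] (β : Module.Basis κ k Ω)
    (V : Submodule k M) {w : M ⊗[k] Ω}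
    (hw : ∀ i, TensorProduct.equivFinsuppOfBasisRight β w i ∈ V) :
    w ∈ LinearMap.range (V.subtype.rTensor Ω) := by
  rw [← (TensorProduct.equivFinsuppOfBasisRight β).symm_apply_apply w,
    TensorProduct.equivFinsuppOfBasisRight_symm_apply]
  exact Submodule.sum_mem _ fun i _ => ⟨⟨_, hw i⟩ ⊗ₜ β i, by simp⟩

theorem tmul_one_injective {B S : Type*} [Ring B] [Algebra k B] [Ring S] [Nontrivial S]
    [Algebra k S] : Function.Injective (fun b : B => b ⊗ₜ[k] (1 : S)) :=
  Algebra.TensorProduct.includeLeft_injective (S := k) (FaithfulSMul.algebraMap_injective k S)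

/-- A vector lies in a subspace if it does so after extension of scalars. -/
theorem mem_range_of_tmul_mem_range_rTensor {S : Type*} [Ring S] [Nontrivial S] [Algebra k S]
    (f : N →ₗ[k] M) {a : M} (ha : a ⊗ₜ[k] (1 : S) ∈ LinearMap.range (f.rTensor S)) :
    a ∈ LinearMap.range f := by
  obtain ⟨z, hz⟩ := ha
  rw [← (LinearMap.range f).ker_mkQ, LinearMap.mem_ker]
  -- The class of `a` modulo the range dies after tensoring with `S`; by flatness it was already
  -- zero.
  have h0 : (LinearMap.range f).mkQ.rTensor S (a ⊗ₜ[k] (1 : S)) = 0 := by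
    rw [← hz, ← LinearMap.comp_apply, ← LinearMap.rTensor_comp, LinearMap.range_mkQ_comp,
      LinearMap.rTensor_zero, LinearMap.zero_apply]
  rw [LinearMap.rTensor_tmul] at h0
  have hinj : Function.Injective
      ((Algebra.linearMap k S).lTensor (M ⧸ LinearMap.range f)) :=
    Module.Flat.lTensor_preserves_injective_linearMap _ (FaithfulSMul.algebraMap_injective k S)
  have h1 : (Algebra.linearMap k S).lTensor (M ⧸ LinearMap.range f)
      ((LinearMap.range f).mkQ a ⊗ₜ[k] (1 : k)) = 0 := by
    rw [LinearMap.lTensor_tmul, Algebra.linearMap_apply, map_one, h0]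
  have h2 := hinj (h1.trans (map_zero _).symm)
  simpa using congrArg (TensorProduct.rid k _) h2

end TensorSubspace

/-! ### Descending the existence of units -/

section UnitOfSubspace

variable {k Ω : Type*} [Field k] [Field Ω] [Algebra k Ω]

theorem isUnit_of_mul_left_injective {k B : Type*} [Field k] [Ring B] [Algebra k B]
    [FiniteDimensional k B] {v : B} (hv : ∀ x, v * x = 0 → x = 0) : IsUnit v := by
  have := IsArtinianRing.of_finite k B
  obtain ⟨x, hx⟩ := (LinearMap.injective_iff_surjective (f := LinearMap.mulLeft k v)).1
    ((injective_iff_map_eq_zero _).2 hv) 1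
  exact IsUnit.of_mul_eq_one _ hx

theorem isUnit_of_isUnit_tmul_one {B : Type*} [Ring B] [Algebra k B] [FiniteDimensional k B]
    {v : B} (hv : IsUnit (v ⊗ₜ[k] (1 : Ω))) : IsUnit v := by
  refine isUnit_of_mul_left_injective (k := k) fun x hx => ?_
  refine tmul_one_injective (k := k) (S := Ω) ?_
  have : v ⊗ₜ[k] (1 : Ω) * x ⊗ₜ[k] (1 : Ω) = 0 := by
    rw [Algebra.TensorProduct.tmul_mul_tmul, hx, TensorProduct.zero_tmul]
  simpa using (hv.mul_right_eq_zero).1 this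

/-- Seen from the other factor, the tensor product is a finite-dimensional `Ω`-algebra, where a
non-zero-divisor is invertible. -/
theorem isUnit_tensor_of_mul_left_injective {B : Type*} [CommRing B] [Algebra k B]
    [FiniteDimensional k B] {z : B ⊗[k] Ω} (hz : ∀ x, z * x = 0 → x = 0) : IsUnit z := by
  have h : IsUnit (Algebra.TensorProduct.comm k B Ω z) := by
    refine isUnit_of_mul_left_injective (k := Ω) fun x hx => ?_
    have := hz ((Algebra.TensorProduct.comm k B Ω).symm x)
      ((Algebra.TensorProduct.comm k B Ω).injective (by simpa using hx))
    simpa using this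
  simpa using h.map (Algebra.TensorProduct.comm k B Ω).symm

/-- Let `f` embed the reduced algebra `E` in `B`, and let `V` be an `E`-subspace of `B` that
becomes the free `E`-module generated by the unit `w` after extension of scalars.  Then `V`
contains a unit of `B`. -/
theorem exists_isUnit_mem_of_baseChange {B E : Type*} [Ring B] [Algebra k B]
    [FiniteDimensional k B] [CommRing E] [Algebra k E] [FiniteDimensional k E] [IsReduced E]
    (f : E →ₐ[k] B) (hf : Function.Injective f) (V : Submodule k B)
    (hV : ∀ v ∈ V, ∀ x, v * f x ∈ V) (w : (B ⊗[k] Ω)ˣ)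
    (hw : (w : B ⊗[k] Ω) ∈ LinearMap.range (V.subtype.rTensor Ω))
    (hVw : ∀ v ∈ V, ∃ z : E ⊗[k] Ω,
      v ⊗ₜ[k] (1 : Ω) = w * Algebra.TensorProduct.map f (AlgHom.id k Ω) z) :
    ∃ v ∈ V, IsUnit v := by
  classical
  have := IsArtinianRing.of_finite k E
  have := Fintype.ofFinite (MaximalSpectrum E)
  let φ := IsArtinianRing.equivPi E
  -- The primitive idempotents of `E`, a finite product of fields because it is reduced and
  -- Artinian.
  let e : MaximalSpectrum E → E := fun m => φ.symm (Pi.single m 1)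
  have hne (m) : e m ≠ 0 := by
    have := m.isMaximal
    have : Nontrivial (E ⧸ m.asIdeal) := Ideal.Quotient.nontrivial_iff.2 m.isMaximal.ne_top
    simp [e]
  have hmul (m m') (h : m ≠ m') : e m * e m' = 0 := by
    apply φ.injective
    rw [map_mul, map_zero]
    simp only [e, AlgEquiv.apply_symm_apply, ← Pi.single_mul_left]
    rw [Pi.single_eq_of_ne h]; simp
  have hsq (m) : e m * e m = e m := by
    apply φ.injective
    rw [map_mul]
    simp only [e, AlgEquiv.apply_symm_apply, ← Pi.single_mul_left]
    simp
  have hsum : ∑ m, e m = 1 := by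
    apply φ.injective
    rw [map_sum, map_one]
    simp only [e, AlgEquiv.apply_symm_apply]
    exact Finset.univ_sum_single 1
  have hinv (m) (x : E) (hx : e m * x ≠ 0) : ∃ y, e m * x * y = e m := by
    let := Ideal.Quotient.field m.asIdeal
    have h1 : φ x m ≠ 0 := by
      intro h
      apply hx
      apply φ.injective
      rw [map_mul, map_zero]
      simp only [e, AlgEquiv.apply_symm_apply, ← Pi.single_mul_left]
      rw [h]; simp
    refine ⟨φ.symm (Pi.single m (φ x m)⁻¹), φ.injective ?_⟩
    simp only [e, map_mul, AlgEquiv.apply_symm_apply, ← Pi.single_mul_left]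
    rw [Pi.single_eq_same, one_mul, mul_inv_cancel₀ h1]
  -- If `e m` killed `V` it would kill `w`, which lies in the scalar extension of `V` and is
  -- invertible.
  have hex (m) : ∃ v ∈ V, v * f (e m) ≠ 0 := by
    by_contra! h
    obtain ⟨u, hu⟩ := hw
    have h1 : ((LinearMap.mulRight k (f (e m))).comp V.subtype) = 0 := by
      ext v; simpa using h v v.2
    have h2 : (w : B ⊗[k] Ω) * (f (e m) ⊗ₜ[k] 1) = 0 := by
      have h3 : ∀ x : B ⊗[k] Ω, x * (f (e m) ⊗ₜ[k] 1) =
          (LinearMap.mulRight k (f (e m))).rTensor Ω x := by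
        intro x
        induction x with
        | zero => simp
        | add x y hx hy => rw [add_mul, hx, hy, map_add]
        | tmul a c => simp
      rw [h3, ← hu, ← LinearMap.comp_apply, ← LinearMap.rTensor_comp, h1]
      simp
    have h4 : f (e m) = 0 :=
      tmul_one_injective (k := k) (S := Ω) (by simpa using (w.isUnit.mul_right_eq_zero).1 h2)
    exact hne m (hf (by rw [h4, map_zero]))
  choose v hv hve using hex
  -- Gluing along the idempotents, rather than taking a generic combination, works over finite
  -- fields too. As each factor of `E` is a field, `x ↦ a * f x` is injective.
  let a := ∑ m, v m * f (e m)
  have haV : a ∈ V := V.sum_mem fun m _ => hV _ (hv m) _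
  have hae (m) : a * f (e m) = v m * f (e m) := by
    simp only [a, Finset.sum_mul]
    rw [Finset.sum_eq_single m]
    · rw [mul_assoc, ← map_mul, hsq]
    · intro m' _ h
      rw [mul_assoc, ← map_mul, hmul _ _ h, map_zero, mul_zero]
    · simp
  have hinj (x : E) (hx : a * f x = 0) : x = 0 := by
    rw [← one_mul x, ← hsum, Finset.sum_mul]
    refine Finset.sum_eq_zero fun m _ => ?_
    by_contra h
    obtain ⟨y, hy⟩ := hinv m x h
    apply hve m
    rw [← hae, ← hy, mul_comm (e m) x, mul_assoc, map_mul, ← mul_assoc, hx, zero_mul]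
  refine ⟨a, haV, isUnit_of_isUnit_tmul_one (k := k) (Ω := Ω) ?_⟩
  obtain ⟨z, hz⟩ := hVw a haV
  rw [hz]
  -- Flatness keeps `x ↦ a * f x` injective over `Ω`; hence `z` is a non-zero-divisor, so a unit.
  refine w.isUnit.mul (IsUnit.map _ (isUnit_tensor_of_mul_left_injective fun x hx => ?_))
  have h1 : Function.Injective
      (((LinearMap.mulLeft k a).comp f.toLinearMap).rTensor Ω) :=
    Module.Flat.rTensor_preserves_injective_linearMap _ ((injective_iff_map_eq_zero _).2 hinj)
  apply h1
  rw [map_zero]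
  have h2 : ((LinearMap.mulLeft k a).comp f.toLinearMap).rTensor Ω x =
      a ⊗ₜ[k] (1 : Ω) * Algebra.TensorProduct.map f (AlgHom.id k Ω) x := by
    clear hx
    induction x with
    | zero => simp
    | add x y hx hy => rw [map_add, map_add, mul_add, hx, hy]
    | tmul a c => simp
  rw [h2, hz, mul_assoc, ← map_mul, hx, map_zero, mul_zero]

end UnitOfSubspace

/-! ### Simplicity of central simple algebras after base change -/

section CentralSimpleBaseChange

variable {k Ω A : Type*} [Field k] [Field Ω] [Algebra k Ω] [Ring A] [Algebra k A]

/-- The base change of a central simple algebra is simple. -/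
theorem isSimpleRing_baseChange [Algebra.IsCentral k A] [IsSimpleRing A] :
    IsSimpleRing (Ω ⊗[k] A) := by
  classical
  let β := Module.Basis.ofVectorSpace k Ω
  let c : Ω ⊗[k] A ≃ₗ[k] _ →₀ A := TensorProduct.equivFinsuppOfBasisLeft β
  have hcl (a : A) (x i) : c ((1 ⊗ₜ a) * x) i = a * c x i := by
    induction x with
    | zero => simp
    | add x y hx hy => simp only [mul_add, map_add, Finsupp.add_apply, hx, hy]
    | tmul r b => simp [c]
  have hcr (a : A) (x i) : c (x * (1 ⊗ₜ a)) i = c x i * a := by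
    induction x with
    | zero => simp
    | add x y hx hy => simp only [add_mul, map_add, Finsupp.add_apply, hx, hy]
    | tmul r b => simp [c]
  have : Nontrivial (Ω ⊗[k] A) := by
    have : Function.Injective (fun r : Ω => r ⊗ₜ[k] (1 : A)) := tmul_one_injective
    exact this.nontrivial
  refine ⟨⟨fun I => or_iff_not_imp_left.2 fun hI => ?_⟩⟩
  obtain ⟨x, ⟨hxI, hx0⟩, hmin⟩ := WellFounded.has_min
    (measure fun x : Ω ⊗[k] A => (c x).support.card).wf {x | x ∈ I ∧ x ≠ 0} (by
      by_contra h
      refine hI (le_bot_iff.1 fun x hx => ?_)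
      rw [TwoSidedIdeal.mem_bot]
      by_contra hx0
      exact h ⟨x, hx, hx0⟩)
  have hmin' : ∀ y ∈ I, (c y).support ⊂ (c x).support → y = 0 := fun y hy hlt => by
    by_contra hy0
    exact hmin y ⟨hy, hy0⟩ (Finset.card_lt_card hlt)
  obtain ⟨j, hj⟩ : ∃ j, c x j ≠ 0 := by
    by_contra! h
    exact hx0 (c.injective (by ext i; simp [h]))
  -- The `j`-th coordinates of the elements of `I` supported inside the minimal support. This ideal
  -- of `A` is nonzero, so it contains 1.
  let J : TwoSidedIdeal A := TwoSidedIdeal.mk'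
    {a | ∃ y ∈ I, (c y).support ⊆ (c x).support ∧ c y j = a}
    ⟨0, I.zero_mem, by simp, by simp⟩
    (by
      rintro _ _ ⟨y, hy, hys, rfl⟩ ⟨z, hz, hzs, rfl⟩
      refine ⟨y + z, I.add_mem hy hz, ?_, by simp⟩
      rw [map_add]
      exact Finsupp.support_add.trans (Finset.union_subset hys hzs))
    (by
      rintro _ ⟨y, hy, hys, rfl⟩
      exact ⟨-y, I.neg_mem hy, by simpa using hys, by simp⟩)
    (by
      rintro a _ ⟨y, hy, hys, rfl⟩
      refine ⟨(1 ⊗ₜ a) * y, I.mul_mem_left _ _ hy, fun i hi => hys ?_, hcl _ _ _⟩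
      rw [Finsupp.mem_support_iff, hcl] at hi
      exact Finsupp.mem_support_iff.2 (right_ne_zero_of_mul hi))
    (by
      rintro _ a ⟨y, hy, hys, rfl⟩
      refine ⟨y * (1 ⊗ₜ a), I.mul_mem_right _ _ hy, fun i hi => hys ?_, hcr _ _ _⟩
      rw [Finsupp.mem_support_iff, hcr] at hi
      exact Finsupp.mem_support_iff.2 (left_ne_zero_of_mul hi))
  have hJ : J = ⊤ := by
    refine (eq_bot_or_eq_top J).resolve_left fun h => hj ?_
    rw [← TwoSidedIdeal.mem_bot, ← h, TwoSidedIdeal.mem_mk']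
    exact ⟨x, hxI, subset_rfl, rfl⟩
  have h1 : (1 : A) ∈ J := hJ ▸ TwoSidedIdeal.mem_top A
  rw [TwoSidedIdeal.mem_mk'] at h1
  obtain ⟨y, hyI, hys, hyj⟩ := h1
  -- The commutator lies in `I` and its `j`-th coordinate is `a * 1 - 1 * a = 0`, so minimality
  -- kills it. Thus the coordinates of `y` are central, and `y` is a nonzero scalar of `Ω`.
  have hcomm (a : A) : (1 ⊗ₜ a) * y = y * (1 ⊗ₜ a) := by
    rw [← sub_eq_zero]
    refine hmin' _ (I.sub_mem (I.mul_mem_left _ _ hyI) (I.mul_mem_right _ _ hyI)) ?_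
    refine Finset.ssubset_iff_subset_ne.2 ⟨fun i hi => hys ?_, fun h => ?_⟩
    · rw [Finsupp.mem_support_iff, map_sub, Finsupp.sub_apply, hcl, hcr] at hi
      rw [Finsupp.mem_support_iff]
      rintro h
      simp [h] at hi
    · have := Finsupp.mem_support_iff.2 hj
      rw [← h, Finsupp.mem_support_iff, map_sub, Finsupp.sub_apply, hcl, hcr, hyj] at this
      simp at this
  have hcen (i) : ∃ r : k, algebraMap k A r = c y i := by
    have : c y i ∈ Subalgebra.center k A := by
      rw [Subalgebra.mem_center_iff]
      intro a
      rw [← hcl, hcomm, hcr]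
    rwa [Algebra.IsCentral.center_eq_bot, Algebra.mem_bot] at this
  choose r hr using hcen
  have hy : ∃ ω : Ω, y = ω ⊗ₜ 1 := by
    refine ⟨(c y).support.sum fun i => r i • β i, ?_⟩
    conv_lhs => rw [← c.symm_apply_apply y]
    rw [TensorProduct.equivFinsuppOfBasisLeft_symm_apply, Finsupp.sum, TensorProduct.sum_tmul]
    refine Finset.sum_congr rfl fun i _ => ?_
    rw [← hr, Algebra.algebraMap_eq_smul_one, TensorProduct.tmul_smul, TensorProduct.smul_tmul']
  obtain ⟨ω, rfl⟩ := hy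
  have hω : ω ≠ 0 := by
    rintro rfl
    simp at hyj
  have : (1 : Ω ⊗[k] A) ∈ I := by
    have := I.mul_mem_left (ω⁻¹ ⊗ₜ 1) _ hyI
    rwa [Algebra.TensorProduct.tmul_mul_tmul, inv_mul_cancel₀ hω, mul_one,
      ← Algebra.TensorProduct.one_def] at this
  exact top_le_iff.1 fun z _ => by simpa using I.mul_mem_left z _ this

end CentralSimpleBaseChange

/-! ### Split algebras inside matrix algebras -/

section DiagonalEmbeddings

open Matrix

variable {Ω ι : Type*} [Field Ω] [Fintype ι] [DecidableEq ι]

/-- An embedding of the split algebra `Ω ^ n` in the algebra of `n × n` matrices is conjugate to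
the diagonal embedding. -/
theorem exists_conj_diagonal (f : (ι → Ω) →ₐ[Ω] Matrix ι ι Ω) (hf : Function.Injective f) :
    ∃ P : (Matrix ι ι Ω)ˣ, ∀ x, f x * P = P * diagonal x := by
  have hex (i) : ∃ u : ι → Ω, f (Pi.single i 1) *ᵥ u ≠ 0 := by
    by_contra! h
    have : f (Pi.single i 1) = 0 := by
      ext a b
      have := congrFun (h (Pi.single b 1)) a
      simpa using this
    have := hf (this.trans (map_zero f).symm)
    simpa using congrFun this i
  choose u hu using hex
  let p : ι → ι → Ω := fun i => f (Pi.single i 1) *ᵥ u i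
  have hp (x i) : f x *ᵥ p i = x i • p i := by
    simp only [p, mulVec_mulVec, ← map_mul]
    have : x * Pi.single i 1 = x i • Pi.single i (1 : Ω) := by
      rw [← Pi.single_mul_right, mul_one, ← Pi.single_smul, smul_eq_mul, mul_one]
    rw [this, map_smul, smul_mulVec]
  have hli : LinearIndependent Ω p := by
    rw [Fintype.linearIndependent_iff]
    intro c hc i
    have := congrArg (f (Pi.single i 1) *ᵥ ·) hc
    simp only [mulVec_sum, mulVec_smul, hp, mulVec_zero] at this
    rw [Finset.sum_eq_single i (by intro j _ hj; simp [hj]) (by simp)] at this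
    simpa [hu i, p] using this
  have hU : IsUnit (Matrix.of p)ᵀ := by
    rw [Matrix.isUnit_transpose]
    exact linearIndependent_rows_iff_isUnit.1 hli
  refine ⟨hU.unit, fun x => ?_⟩
  ext a i
  rw [IsUnit.unit_spec, mul_diagonal]
  have := congrFun (hp x i) a
  simpa [mulVec, dotProduct, mul_apply, mul_comm] using this

theorem exists_diagonal_of_commute {M : Matrix ι ι Ω}
    (hM : ∀ x : ι → Ω, diagonal x * M = M * diagonal x) : ∃ x, M = diagonal x := by
  refine ⟨fun i => M i i, ?_⟩
  ext a b
  by_cases h : a = b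
  · subst h; simp
  · have := congrFun (congrFun (hM (Pi.single a 1)) a) b
    rw [diagonal_mul, mul_diagonal] at this
    simpa [h, Ne.symm h] using this

theorem mem_range_of_commute_split {C D : Type*} [Ring C] [Algebra Ω C] [Ring D] [Algebra Ω D]
    (γ : C ≃ₐ[Ω] (ι → Ω)) (δ : D ≃ₐ[Ω] Matrix ι ι Ω) (f : C →ₐ[Ω] D)
    (hf : Function.Injective f) {d : D} (hd : ∀ x, f x * d = d * f x) : ∃ x, f x = d := by
  obtain ⟨P, hP⟩ := exists_conj_diagonal
    ((δ : D →ₐ[Ω] Matrix ι ι Ω).comp (f.comp (γ.symm : (ι → Ω) →ₐ[Ω] C)))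
    (δ.injective.comp (hf.comp γ.symm.injective))
  have hP' (x : ι → Ω) : δ (f (γ.symm x)) = P * diagonal x * P⁻¹ :=
    (Units.eq_mul_inv_iff_mul_eq _).2 (hP x)
  obtain ⟨x, hx⟩ := exists_diagonal_of_commute
    (M := (((P⁻¹ : (Matrix ι ι Ω)ˣ) : Matrix ι ι Ω) * δ d * (P : Matrix ι ι Ω))) fun x => by
    have := congrArg
      (fun m => ((P⁻¹ : (Matrix ι ι Ω)ˣ) : Matrix ι ι Ω) * δ m * (P : Matrix ι ι Ω)) (hd (γ.symm x))
    simp only [map_mul, hP'] at this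
    simpa [mul_assoc] using this
  refine ⟨γ.symm x, δ.injective ?_⟩
  rw [hP', ← hx]
  simp [mul_assoc]

theorem exists_conj_split {C D : Type*} [Ring C] [Algebra Ω C] [Ring D] [Algebra Ω D]
    (γ : C ≃ₐ[Ω] (ι → Ω)) (δ : D ≃ₐ[Ω] Matrix ι ι Ω) (f f' : C →ₐ[Ω] D)
    (hf : Function.Injective f) (hf' : Function.Injective f') :
    ∃ y : Dˣ, ∀ x, f x * y = y * f' x := by
  obtain ⟨P, hP⟩ := exists_conj_diagonal
    ((δ : D →ₐ[Ω] Matrix ι ι Ω).comp (f.comp (γ.symm : (ι → Ω) →ₐ[Ω] C)))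
    (δ.injective.comp (hf.comp γ.symm.injective))
  obtain ⟨P', hP'⟩ := exists_conj_diagonal
    ((δ : D →ₐ[Ω] Matrix ι ι Ω).comp (f'.comp (γ.symm : (ι → Ω) →ₐ[Ω] C)))
    (δ.injective.comp (hf'.comp γ.symm.injective))
  have h (x : ι → Ω) : δ (f (γ.symm x)) = P * diagonal x * P⁻¹ :=
    (Units.eq_mul_inv_iff_mul_eq _).2 (hP x)
  have h' (x : ι → Ω) : δ (f' (γ.symm x)) = P' * diagonal x * P'⁻¹ :=
    (Units.eq_mul_inv_iff_mul_eq _).2 (hP' x)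
  refine ⟨Units.map (δ.symm : Matrix ι ι Ω →* D) (P * P'⁻¹), fun x => δ.injective ?_⟩
  obtain ⟨x, rfl⟩ := γ.symm.surjective x
  rw [map_mul δ (f _), map_mul δ _ (f' _), h, h']
  simp [mul_assoc]

end DiagonalEmbeddings

/-! ### Maximal étale subalgebras: centralizers and conjugacy -/

section MaximalEtale

variable {L A E : Type*} [Field L] [Ring A] [Algebra L A] [Algebra.IsCentral L A] [IsSimpleRing A]
  [FiniteDimensional L A] [CommRing E] [Algebra L E] [Algebra.Etale L E]

theorem Algebra.Etale.finiteDimensional : FiniteDimensional L E :=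
  Algebra.FormallyUnramified.finite_of_free L E

theorem exists_splitting (n : ℕ) (hA : Module.finrank L A = n ^ 2) (hE : Module.finrank L E = n) :
    Nonempty ((AlgebraicClosure L ⊗[L] E) ≃ₐ[AlgebraicClosure L] (Fin n → AlgebraicClosure L)) ∧
    Nonempty ((AlgebraicClosure L ⊗[L] A) ≃ₐ[AlgebraicClosure L]
      Matrix (Fin n) (Fin n) (AlgebraicClosure L)) := by
  set Ω := AlgebraicClosure L
  constructor
  · have e := Algebra.FormallyEtale.equivPiOfIsSepClosed Ω (Ω ⊗[L] E)
    have : Module.Finite Ω (Ω ⊗[L] E) := Algebra.Etale.finiteDimensional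
    have : IsArtinianRing (Ω ⊗[L] E) := isArtinian_of_tower Ω inferInstance
    have := Fintype.ofFinite (PrimeSpectrum (Ω ⊗[L] E))
    have h := e.toLinearEquiv.finrank_eq
    rw [Module.finrank_baseChange, hE, Module.finrank_pi] at h
    exact ⟨e.trans (AlgEquiv.piCongrLeft Ω (fun _ => Ω)
      (Fintype.equivFinOfCardEq h.symm))⟩
  · have : IsSimpleRing (Ω ⊗[L] A) := isSimpleRing_baseChange
    obtain ⟨m, _, ⟨e⟩⟩ := IsSimpleRing.exists_algEquiv_matrix_of_isAlgClosed Ω (Ω ⊗[L] A)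
    have h := e.toLinearEquiv.finrank_eq
    rw [Module.finrank_baseChange, hA, Module.finrank_matrix, Module.finrank_self, mul_one,
      Fintype.card_fin, ← sq, Nat.pow_left_inj two_ne_zero] at h
    subst h
    exact ⟨e⟩

/-- An étale subalgebra of dimension `n` of a central simple algebra of dimension `n ^ 2` is its
own centralizer. -/
theorem mem_range_of_commute (n : ℕ) (hA : Module.finrank L A = n ^ 2)
    (hE : Module.finrank L E = n) (f : E →ₐ[L] A) (hf : Function.Injective f) {a : A}
    (ha : ∀ x, f x * a = a * f x) : ∃ x, f x = a := by
  obtain ⟨⟨γ⟩, ⟨δ⟩⟩ := exists_splitting (L := L) (A := A) (E := E) n hA hE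
  set Ω := AlgebraicClosure L
  let F : Ω ⊗[L] E →ₐ[Ω] Ω ⊗[L] A := Algebra.TensorProduct.map (AlgHom.id Ω Ω) f
  have hF : Function.Injective F :=
    Module.Flat.lTensor_preserves_injective_linearMap f.toLinearMap hf
  -- In the split situation a matrix commuting with all diagonal matrices is diagonal; membership in
  -- the range then descends to `L`.
  obtain ⟨x, hx⟩ := mem_range_of_commute_split γ δ F hF (d := 1 ⊗ₜ a) fun x => by
    induction x with
    | zero => simp
    | add x y hx hy => rw [map_add, add_mul, mul_add, hx, hy]
    | tmul r b => simp [F, ha]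
  refine mem_range_of_tmul_mem_range_rTensor (S := Ω) f.toLinearMap
    ⟨TensorProduct.comm L Ω E x, ?_⟩
  refine Eq.trans ?_ (congrArg (TensorProduct.comm L Ω A) hx)
  rw [← LinearMap.comm_comp_lTensor_comp_comm_eq]
  simp only [LinearMap.comp_apply, LinearEquiv.coe_coe, TensorProduct.comm_comm]
  rfl

/-- **Skolem–Noether** for étale subalgebras of dimension `n` in a central simple algebra of
dimension `n ^ 2`: any two embeddings are conjugate. -/
theorem exists_conj_of_etale (n : ℕ) (hA : Module.finrank L A = n ^ 2)
    (hE : Module.finrank L E = n) (f f' : E →ₐ[L] A) (hf : Function.Injective f)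
    (hf' : Function.Injective f') : ∃ h : Aˣ, ∀ x, f' x * h = h * f x := by
  classical
  obtain ⟨⟨γ⟩, ⟨δ⟩⟩ := exists_splitting (L := L) (A := A) (E := E) n hA hE
  set Ω := AlgebraicClosure L
  have : FiniteDimensional L E := Algebra.Etale.finiteDimensional
  have : IsReduced E := Algebra.FormallyUnramified.isReduced_of_field L E
  let F (f : E →ₐ[L] A) : Ω ⊗[L] E →ₐ[Ω] Ω ⊗[L] A := Algebra.TensorProduct.map (AlgHom.id Ω Ω) f
  have hF (f : E →ₐ[L] A) (hf : Function.Injective f) : Function.Injective (F f) :=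
    Module.Flat.lTensor_preserves_injective_linearMap f.toLinearMap hf
  obtain ⟨y, hy⟩ := exists_conj_split γ δ (F f') (F f) (hF f' hf') (hF f hf)
  let sw : Ω ⊗[L] A ≃ₐ[L] A ⊗[L] Ω := Algebra.TensorProduct.comm L Ω A
  let w : (A ⊗[L] Ω)ˣ := Units.map (sw : Ω ⊗[L] A →* A ⊗[L] Ω) y
  have hw (x : E) : f' x ⊗ₜ[L] (1 : Ω) * w = w * f x ⊗ₜ[L] (1 : Ω) := by
    have := congrArg sw (hy (1 ⊗ₜ x))
    simpa [F, sw, w] using this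
  -- The intertwiners from `f` to `f'`: a conjugating element is a unit in this space, and `y`
  -- provides one over `Ω`.
  let V : Submodule L A :=
    { carrier := {a | ∀ x, f' x * a = a * f x}
      add_mem' := fun {a b} ha hb x => by rw [mul_add, add_mul, ha, hb]
      zero_mem' := fun x => by simp
      smul_mem' := fun c a ha x => by rw [mul_smul_comm, smul_mul_assoc, ha] }
  obtain ⟨v, hv, hvu⟩ := exists_isUnit_mem_of_baseChange f hf V
    (fun v hv x z => by
      rw [← mul_assoc, hv, mul_assoc, mul_assoc, ← map_mul, ← map_mul, mul_comm])
    w (by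
      let β := Module.Basis.ofVectorSpace L Ω
      let c : A ⊗[L] Ω ≃ₗ[L] _ →₀ A := TensorProduct.equivFinsuppOfBasisRight β
      have hcl (a : A) (x i) : c ((a ⊗ₜ 1) * x) i = a * c x i := by
        induction x with
        | zero => simp
        | add x y hx hy => simp only [mul_add, map_add, Finsupp.add_apply, hx, hy]
        | tmul b r => simp [c]
      have hcr (a : A) (x i) : c (x * (a ⊗ₜ 1)) i = c x i * a := by
        induction x with
        | zero => simp
        | add x y hx hy => simp only [add_mul, map_add, Finsupp.add_apply, hx, hy]
        | tmul b r => simp [c]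
      -- The intertwining equations have coefficients in `A`, so they hold for each coordinate of
      -- `w` over `L`.
      exact mem_range_rTensor_of_coord_mem β V fun i x => by
        rw [← hcl, hw, hcr])
    (fun v hv => by
      -- Two intertwiners differ by an element of the centralizer of the image, which is the image
      -- itself.
      obtain ⟨z, hz⟩ := mem_range_of_commute_split γ δ (F f) (hF f hf)
        (d := ((y⁻¹ : (Ω ⊗[L] A)ˣ) : Ω ⊗[L] A) * (1 ⊗ₜ v : Ω ⊗[L] A)) fun x => by
          have h1 : F f x * (y⁻¹ : (Ω ⊗[L] A)ˣ) = (y⁻¹ : (Ω ⊗[L] A)ˣ) * F f' x := by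
            rw [Units.mul_inv_eq_iff_eq_mul, mul_assoc, Units.eq_inv_mul_iff_mul_eq, hy]
          have h2 : F f' x * (1 ⊗ₜ v : Ω ⊗[L] A) = (1 ⊗ₜ v : Ω ⊗[L] A) * F f x := by
            clear h1
            induction x with
            | zero => simp
            | add x y hx hy => rw [map_add, map_add, add_mul, mul_add, hx, hy]
            | tmul r b => simp [F, hv b]
          rw [← mul_assoc, h1, mul_assoc, h2, mul_assoc]
      refine ⟨Algebra.TensorProduct.comm L Ω E z, ?_⟩
      have h1 : (1 ⊗ₜ v : Ω ⊗[L] A) = y * F f z := by rw [hz, Units.mul_inv_cancel_left]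
      have h2 : sw (F f z) = Algebra.TensorProduct.map f (AlgHom.id L Ω)
          (Algebra.TensorProduct.comm L Ω E z) := by
        clear hz h1
        induction z with
        | zero => simp
        | add x y hx hy => simp only [map_add, hx, hy]
        | tmul r b => simp [F, sw]
      rw [← h2]
      simpa [sw, w] using congrArg sw h1)
  exact ⟨hvu.unit, hv⟩

end MaximalEtale

/-! ### Galois descent and Hilbert's Theorem 90 -/

section GaloisDescent

variable {K B Ω : Type*} [Field K] [Ring B] [Algebra K B] [Field Ω] [Algebra K Ω]

variable (B) in
/-- The action of `θ ∈ Gal(Ω/K)` on `B ⊗[K] Ω` through the second factor. -/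
noncomputable abbrev galMap (θ : Ω ≃ₐ[K] Ω) : B ⊗[K] Ω →ₐ[K] B ⊗[K] Ω :=
  Algebra.TensorProduct.map (AlgHom.id K B) (θ : Ω →ₐ[K] Ω)

theorem coord_galMap {κ : Type*} [DecidableEq κ] (β : Module.Basis κ K B) (θ : Ω ≃ₐ[K] Ω)
    (x : B ⊗[K] Ω) (i : κ) : TensorProduct.equivFinsuppOfBasisLeft β (galMap B θ x) i =
      θ (TensorProduct.equivFinsuppOfBasisLeft β x i) := by
  induction x with
  | zero => simp
  | add x y hx hy => simp only [map_add, Finsupp.add_apply, hx, hy]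
  | tmul b r => simp

theorem coord_scalar_mul {κ : Type*} [DecidableEq κ] (β : Module.Basis κ K B) (r : Ω)
    (x : B ⊗[K] Ω) (i : κ) : TensorProduct.equivFinsuppOfBasisLeft β ((1 ⊗ₜ r) * x) i =
      r * TensorProduct.equivFinsuppOfBasisLeft β x i := by
  induction x with
  | zero => simp
  | add x y hx hy => simp only [mul_add, map_add, Finsupp.add_apply, hx, hy]
  | tmul b r => simp

/-- The coordinates in a `K`-basis of `B` are Galois-fixed elements of `Ω`, hence lie in `K`. -/
theorem exists_eq_tmul_one_of_galMap_eq [IsGalois K Ω] {x : B ⊗[K] Ω}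
    (hx : ∀ θ : Ω ≃ₐ[K] Ω, galMap B θ x = x) : ∃ b : B, x = b ⊗ₜ 1 := by
  classical
  let β := Module.Basis.ofVectorSpace K B
  let c : B ⊗[K] Ω ≃ₗ[K] _ →₀ Ω := TensorProduct.equivFinsuppOfBasisLeft β
  have h (i) : ∃ r, algebraMap K Ω r = c x i :=
    (InfiniteGalois.mem_range_algebraMap_iff_fixed _).2 fun θ => by
      rw [← coord_galMap, hx]
  choose r hr using h
  refine ⟨(c x).support.sum fun i => r i • β i, ?_⟩
  conv_lhs => rw [← c.symm_apply_apply x]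
  rw [TensorProduct.equivFinsuppOfBasisLeft_symm_apply, Finsupp.sum, TensorProduct.sum_tmul]
  refine Finset.sum_congr rfl fun i _ => ?_
  rw [← hr, Algebra.algebraMap_eq_smul_one, TensorProduct.tmul_smul, TensorProduct.smul_tmul']

/-- **Galois descent** for subspaces: a Galois-stable `Ω`-subspace of `B ⊗[K] Ω` is spanned by its
elements in `B`. -/
theorem mem_range_rTensor_of_galois_stable [IsGalois K Ω] (W : Submodule K (B ⊗[K] Ω))
    (hscalar : ∀ w ∈ W, ∀ r : Ω, (1 ⊗ₜ r) * w ∈ W)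
    (hgal : ∀ w ∈ W, ∀ θ : Ω ≃ₐ[K] Ω, galMap B θ w ∈ W) {w : B ⊗[K] Ω} (hw : w ∈ W) :
    w ∈ LinearMap.range
      ((W.comap ((TensorProduct.mk K B Ω).flip 1)).subtype.rTensor Ω) := by
  classical
  let β := Module.Basis.ofVectorSpace K B
  let c : B ⊗[K] Ω ≃ₗ[K] _ →₀ Ω := TensorProduct.equivFinsuppOfBasisLeft β
  have hcg (θ : Ω ≃ₐ[K] Ω) (x i) : c (galMap B θ x) i = θ (c x i) := coord_galMap β θ x i
  have hcs (r x i) : c ((1 ⊗ₜ r) * x) i = r * c x i := coord_scalar_mul β r x i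
  induction hN : (c w).support.card using Nat.strong_induction_on generalizing w with
  | _ N ih =>
  subst hN
  by_cases hw0 : w = 0
  · rw [hw0]; exact Submodule.zero_mem _
  obtain ⟨x, ⟨hxW, hx0, hxs⟩, hmin⟩ := WellFounded.has_min
    (measure fun x : B ⊗[K] Ω => (c x).support.card).wf
    {x | x ∈ W ∧ x ≠ 0 ∧ (c x).support ⊆ (c w).support} ⟨w, hw, hw0, subset_rfl⟩
  obtain ⟨j, hj⟩ : ∃ j, c x j ≠ 0 := by
    by_contra! h
    exact hx0 (c.injective (by ext i; simp [h]))
  let y := (1 ⊗ₜ (c x j)⁻¹) * x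
  have hyW : y ∈ W := hscalar _ hxW _
  have hyj : c y j = 1 := by rw [hcs, inv_mul_cancel₀ hj]
  have hys (i) (hi : c x i = 0) : c y i = 0 := by rw [hcs, hi, mul_zero]
  -- Since the `j`-th coordinate of `y` is 1, that of `θ(y) - y` vanishes; minimality of the support
  -- forces `θ(y) = y`.
  obtain ⟨b, hb⟩ : ∃ b : B, y = b ⊗ₜ 1 := exists_eq_tmul_one_of_galMap_eq fun θ => by
    rw [← sub_eq_zero]
    by_contra h0
    have hsub (i) (hi : c (galMap B θ y - y) i ≠ 0) : c x i ≠ 0 := by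
      rintro h
      apply hi
      rw [map_sub, Finsupp.sub_apply, hcg, hys i h, map_zero, sub_zero]
    refine hmin _ ⟨W.sub_mem (hgal _ hyW θ) hyW, h0, fun i hi => hxs ?_⟩
      (Finset.card_lt_card (Finset.ssubset_iff_subset_ne.2 ⟨fun i hi => ?_, fun h => ?_⟩))
    · exact Finsupp.mem_support_iff.2 (hsub i (Finsupp.mem_support_iff.1 hi))
    · exact Finsupp.mem_support_iff.2 (hsub i (Finsupp.mem_support_iff.1 hi))
    · have := Finsupp.mem_support_iff.2 hj
      rw [← h, Finsupp.mem_support_iff, map_sub, Finsupp.sub_apply, hcg, hyj] at this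
      simp at this
  -- Subtracting this multiple of `y` removes `j` from the support of `w` and adds nothing to it.
  have hw' : w = (w - (1 ⊗ₜ c w j) * y) + (1 ⊗ₜ c w j) * y := by abel
  rw [hw']
  refine Submodule.add_mem _ (ih _ ?_ (W.sub_mem hw (hscalar _ hyW _)) rfl) ?_
  · refine Finset.card_lt_card (Finset.ssubset_iff_subset_ne.2 ⟨fun i hi => ?_, fun h => ?_⟩)
    · rw [Finsupp.mem_support_iff] at hi ⊢
      rintro h
      apply hi
      have hxi : c x i = 0 := by
        by_contra hne
        exact Finsupp.mem_support_iff.1 (hxs (Finsupp.mem_support_iff.2 hne)) h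
      rw [map_sub, Finsupp.sub_apply, hcs, h, hys i hxi, mul_zero, sub_zero]
    · have := hxs (Finsupp.mem_support_iff.2 hj)
      rw [← h, Finsupp.mem_support_iff, map_sub, Finsupp.sub_apply, hcs, hyj] at this
      simp at this
  · rw [hb]
    exact ⟨⟨b, by simpa [hb] using hyW⟩ ⊗ₜ c w j, by simp⟩

/-- A form of Hilbert's Theorem 90: if the coset of `y` modulo `(E ⊗[K] Ω)ˣ` is Galois-stable,
then it contains a unit of `B`. -/
theorem exists_unit_eq_mul_of_galois_stable [IsGalois K Ω] [FiniteDimensional K B] {E : Type*}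
    [CommRing E] [Algebra K E] [FiniteDimensional K E] [IsReduced E] (f : E →ₐ[K] B)
    (hf : Function.Injective f) (y : (B ⊗[K] Ω)ˣ)
    (hy : ∀ θ : Ω ≃ₐ[K] Ω, ∃ x : E ⊗[K] Ω,
      galMap B θ y = y * Algebra.TensorProduct.map f (AlgHom.id K Ω) x) :
    ∃ (h : Bˣ) (e : (E ⊗[K] Ω)ˣ),
      (h : B) ⊗ₜ[K] (1 : Ω) = y * Algebra.TensorProduct.map f (AlgHom.id K Ω) e := by
  set F : E ⊗[K] Ω →ₐ[K] B ⊗[K] Ω := Algebra.TensorProduct.map f (AlgHom.id K Ω)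
  have hF : Function.Injective F :=
    Module.Flat.rTensor_preserves_injective_linearMap f.toLinearMap hf
  have hFg (θ : Ω ≃ₐ[K] Ω) (z : E ⊗[K] Ω) : galMap B θ (F z) = F (galMap E θ z) := by
    induction z with
    | zero => simp
    | add x y hx hy => simp only [map_add, hx, hy]
    | tmul b r => simp [F]
  let W : Submodule K (B ⊗[K] Ω) :=
    LinearMap.range ((LinearMap.mulLeft K (y : B ⊗[K] Ω)).comp F.toLinearMap)
  have hW (z) : (y : B ⊗[K] Ω) * F z ∈ W := ⟨z, rfl⟩
  obtain ⟨v, hv, hvu⟩ := exists_isUnit_mem_of_baseChange f hf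
    (W.comap ((TensorProduct.mk K B Ω).flip 1))
    (by
      rintro v ⟨z, hz⟩ x
      refine ⟨z * (x ⊗ₜ 1), ?_⟩
      have hz' : (y : B ⊗[K] Ω) * F z = v ⊗ₜ 1 := hz
      change (y : B ⊗[K] Ω) * F (z * (x ⊗ₜ 1)) = (v * f x) ⊗ₜ 1
      rw [map_mul, ← mul_assoc, hz']
      simp [F]) y
    (by
      refine mem_range_rTensor_of_galois_stable W ?_ ?_ (by simpa using hW 1)
      · rintro _ ⟨z, rfl⟩ r
        refine ⟨(1 ⊗ₜ r) * z, ?_⟩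
        change (y : B ⊗[K] Ω) * F ((1 ⊗ₜ r) * z) = (1 ⊗ₜ r) * ((y : B ⊗[K] Ω) * F z)
        have hr : ∀ x : B ⊗[K] Ω, (1 ⊗ₜ r) * x = x * (1 ⊗ₜ r) := fun x => by
          induction x with
          | zero => simp
          | add x y hx hy => rw [mul_add, add_mul, hx, hy]
          | tmul b s => simp [mul_comm]
        rw [map_mul, ← mul_assoc, ← mul_assoc, hr]
        simp [F]
      · rintro _ ⟨z, rfl⟩ θ
        obtain ⟨x, hx⟩ := hy θ
        change galMap B θ (y * F z) ∈ W
        rw [map_mul, hx, hFg, mul_assoc, ← map_mul]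
        exact hW _)
    (by
      rintro v ⟨z, hz⟩
      exact ⟨z, hz.symm⟩)
  obtain ⟨z, hz⟩ := hv
  have hz' : (y : B ⊗[K] Ω) * F z = v ⊗ₜ 1 := hz
  have hFz : IsUnit (F z) := by
    rw [← y.isUnit_units_mul, hz']
    exact hvu.map (Algebra.TensorProduct.includeLeft : B →ₐ[K] B ⊗[K] Ω)
  have hzu : IsUnit z := isUnit_tensor_of_mul_left_injective fun x hx => hF <| by
    rw [map_zero, ← hFz.mul_right_eq_zero, ← map_mul, hx, map_zero]
  exact ⟨hvu.unit, hzu.unit, hz'.symm⟩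

theorem isLocallyConstant_gal_apply [Algebra.IsAlgebraic K Ω] (r : Ω) :
    IsLocallyConstant fun θ : Ω ≃ₐ[K] Ω => θ r := by
  rw [IsLocallyConstant.iff_exists_open]
  intro θ
  -- The coset `θ · Stab(r)`, open because `r` is algebraic.
  refine ⟨(fun θ' => θ⁻¹ * θ') ⁻¹' (MulAction.stabilizer (Ω ≃ₐ[K] Ω) r),
    (stabilizer_isOpen_of_isIntegral r).preimage (continuous_const_mul _), by simp, ?_⟩
  intro θ' h
  have h' : θ⁻¹ (θ' r) = r := h
  rw [AlgEquiv.aut_inv, AlgEquiv.symm_apply_eq] at h'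
  exact h'

theorem isLocallyConstant_galMap [Algebra.IsAlgebraic K Ω] (x : B ⊗[K] Ω) :
    IsLocallyConstant fun θ : Ω ≃ₐ[K] Ω => galMap B θ x := by
  induction x with
  | zero => simp only [map_zero]; exact IsLocallyConstant.const 0
  | add x y hx hy => simp only [map_add]; exact hx.add hy
  | tmul b r => exact (isLocallyConstant_gal_apply r).comp fun r => b ⊗ₜ r

theorem isLocallyConstant_galUnits [Algebra.IsAlgebraic K Ω] (x : (B ⊗[K] Ω)ˣ) :
    IsLocallyConstant fun θ : Ω ≃ₐ[K] Ω => galUnits B θ x :=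
  IsLocallyConstant.desc _ Units.val (isLocallyConstant_galMap (x : B ⊗[K] Ω)) Units.val_injective

end GaloisDescent

/-! ### Hermitian squares over a separably closed field -/

section HermitianSquare

variable {K E Ω : Type*} [Field K] [CommRing E] [Algebra K E] [Field Ω] [Algebra K Ω]

/-- An involution of a commutative algebra as an automorphism. -/
def AlgInvolution.toAlgHom (σ : AlgInvolution K E) : E →ₐ[K] E :=
  AlgHom.ofLinearMap σ.toLinearMap σ.map_one fun x y => by
    rw [mul_comm x y]; exact σ.map_mul_rev y x

@[simp]
theorem AlgInvolution.toAlgHom_apply (σ : AlgInvolution K E) (x : E) : σ.toAlgHom x = σ x := rfl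

theorem AlgInvolution.baseChange_apply {B : Type*} [Ring B] [Algebra K B] (τ : AlgInvolution K B)
    (x : B ⊗[K] Ω) : τ.baseChange Ω x = LinearMap.rTensor Ω τ.toLinearMap x := rfl

/-- If `2` is invertible, a `σ`-fixed unit of an étale algebra has a `σ`-fixed square root over the
separable closure. -/
theorem exists_baseChange_mul_self_of_two_ne_zero [IsSepClosed Ω] [Algebra.Etale K E]
    (h2 : (2 : K) ≠ 0) (σ : AlgInvolution K E) {b : E} (hb : σ b = b) :
    ∃ e : E ⊗[K] Ω, σ.baseChange Ω e * e = b ⊗ₜ 1 := by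
  have : NeZero (2 : Ω) := ⟨by
    rw [← map_ofNat (algebraMap K Ω) 2]
    exact (map_ne_zero _).2 h2⟩
  -- The root depends only on the value, not on the point of the spectrum. As `S` permutes the
  -- coordinates and fixes `1 ⊗ b`, the resulting square root is `S`-fixed.
  choose q hq using fun x : Ω => IsSepClosed.exists_eq_mul_self x
  let ψ := Algebra.FormallyEtale.equivPiOfIsSepClosed Ω (Ω ⊗[K] E)
  let S : Ω ⊗[K] E →ₐ[Ω] Ω ⊗[K] E := Algebra.TensorProduct.map (AlgHom.id Ω Ω) σ.toAlgHom
  have hS (x : Ω ⊗[K] E) (p) : ψ (S x) p = ψ x (p.comap S) :=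
    (Algebra.FormallyEtale.equivPiOfIsSepClosed_comap S x p).symm
  let e : Ω ⊗[K] E := ψ.symm fun p => q (ψ (1 ⊗ₜ b) p)
  have he : e * e = 1 ⊗ₜ b := ψ.injective <| by
    ext p
    rw [map_mul, Pi.mul_apply]
    simp only [e, AlgEquiv.apply_symm_apply]
    exact (hq _).symm
  have hSe : S e = e := ψ.injective <| by
    ext p
    rw [hS]
    simp only [e, AlgEquiv.apply_symm_apply]
    rw [← hS]
    simp [S, hb]
  let sw : Ω ⊗[K] E ≃ₐ[K] E ⊗[K] Ω := Algebra.TensorProduct.comm K Ω E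
  have hsw (x) : σ.baseChange Ω (sw x) = sw (S x) := by
    rw [σ.baseChange_apply]
    induction x with
    | zero => simp
    | add x y hx hy => simp only [map_add, hx, hy]
    | tmul r x => simp [sw, S]
  refine ⟨sw e, ?_⟩
  rw [hsw, hSe, ← map_mul, he]
  rfl

/-- If `σ` moves an element of the étale quadratic centre, every fixed element is a hermitian
square over the separable closure. -/
theorem exists_baseChange_mul_self_of_quadratic [IsSepClosed Ω] {L : Type*} [Field L] [Algebra K L]
    [Algebra L E] [IsScalarTower K L E] (σ : AlgInvolution K E) {α α' : L} (hα : α ≠ α')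
    (hσ : σ (algebraMap L E α) = algebraMap L E α') {t d : K} (ht : algebraMap K L t = α + α')
    (hd : algebraMap K L d = α * α') {b : E} (hb : σ b = b) :
    ∃ e : E ⊗[K] Ω, σ.baseChange Ω e * e = b ⊗ₜ 1 := by
  -- The discriminant is `(α - α')²`; working with it covers characteristic 2 as well.
  have hdisc : t ^ 2 - 4 * d ≠ 0 := by
    intro h
    have := congrArg (algebraMap K L) h
    simp only [map_sub, map_pow, map_mul, ht, hd, map_ofNat, map_zero] at this
    have h' : (α - α') ^ 2 = 0 := by linear_combination this
    exact hα (sub_eq_zero.1 (pow_eq_zero_iff two_ne_zero |>.1 h'))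
  let Q : Polynomial K := .X ^ 2 - .C t * .X + .C d
  have hQ2 : Q.natDegree = 2 := by simp only [Q]; compute_degree!
  have hQs : Q.Separable := by
    -- Bézout coefficients from the identity `Q'² - 4Q = t² - 4d`.
    refine ⟨- .C (4 / (t ^ 2 - 4 * d)), .C ((t ^ 2 - 4 * d)⁻¹) * (.C 2 * .X - .C t), ?_⟩
    have h1 : Polynomial.C ((t ^ 2 - 4 * d)⁻¹) * (.C t ^ 2 - 4 * .C d) = (1 : Polynomial K) := by
      have : (.C t ^ 2 - 4 * .C d : Polynomial K) = .C (t ^ 2 - 4 * d) := by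
        rw [map_sub, map_pow, map_mul, map_ofNat]
      rw [this, ← Polynomial.C_mul, inv_mul_cancel₀ hdisc, Polynomial.C_1]
    have h2 : (Polynomial.C (4 / (t ^ 2 - 4 * d)) : Polynomial K) =
        4 * .C ((t ^ 2 - 4 * d)⁻¹) := by
      rw [div_eq_mul_inv, Polynomial.C_mul, map_ofNat]
    have h3 : (Polynomial.C 2 : Polynomial K) = 2 := map_ofNat _ 2
    rw [h2, h3]
    simp only [Q, Polynomial.derivative_add, Polynomial.derivative_sub, Polynomial.derivative_X_sq,
      Polynomial.derivative_mul, Polynomial.derivative_C, Polynomial.derivative_X]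
    rw [h3]
    linear_combination h1
  obtain ⟨r, hr⟩ := IsSepClosed.exists_aeval_eq_zero Ω Q
    (by rw [Polynomial.degree_eq_natDegree (by rintro h; simp [h] at hQ2), hQ2]; decide) hQs
  have hr' : r ^ 2 - algebraMap K Ω t * r + algebraMap K Ω d = 0 := by simpa [Q] using hr
  have hne : algebraMap K Ω t - 2 * r ≠ 0 := by
    intro h
    apply hdisc
    apply (algebraMap K Ω).injective
    simp only [map_sub, map_pow, map_mul, map_ofNat, map_zero]
    linear_combination (algebraMap K Ω t - 2 * r) * h - 4 * hr'
  set u := (algebraMap K Ω t - 2 * r)⁻¹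
  have hu : u * (algebraMap K Ω t - 2 * r) = 1 := inv_mul_cancel₀ hne
  let a : E ⊗[K] Ω := algebraMap L E α ⊗ₜ 1
  let a' : E ⊗[K] Ω := algebraMap L E α' ⊗ₜ 1
  let I : Ω →ₐ[K] E ⊗[K] Ω := Algebra.TensorProduct.includeRight
  have hsum : a + a' = I (algebraMap K Ω t) := by
    simp only [a, a', I, ← TensorProduct.add_tmul, ← map_add, ← ht]
    rw [← IsScalarTower.algebraMap_apply, AlgHom.commutes]
    rfl
  have hprod : a * a' = I (algebraMap K Ω d) := by
    simp only [a, a', I, Algebra.TensorProduct.tmul_mul_tmul, ← map_mul, ← hd, mul_one]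
    rw [← IsScalarTower.algebraMap_apply, AlgHom.commutes]
    rfl
  let S := (Algebra.TensorProduct.map σ.toAlgHom (AlgHom.id K Ω))
  have hS (x) : σ.baseChange Ω x = S x := rfl
  have hSS (x) : S (S x) = x := by
    rw [← hS, ← hS]; exact (σ.baseChange Ω).apply_apply x
  have hSa : S a = a' := by simp [S, a, a', hσ]
  have hSI (x) : S (I x) = I x := by simp [S, I, σ.map_one]
  -- With `r' = t - r` the other root of `Q`, this is `(a - r)/(r' - r)`, the Lagrange idempotent of
  -- the factor where `a = r'`; `S` exchanges it with its complement.
  let p := I u * (a - I r)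
  have hSp : S p = I u * (a' - I r) := by simp only [p, map_mul, map_sub, hSI, hSa]
  have huI : I u * (I (algebraMap K Ω t) - 2 * I r) = 1 := by
    rw [← map_ofNat I 2, ← map_mul, ← map_sub, ← map_mul, hu, map_one]
  have hrI : I r ^ 2 - I (algebraMap K Ω t) * I r + I (algebraMap K Ω d) = 0 := by
    rw [← map_pow, ← map_mul, ← map_sub, ← map_add, hr', map_zero]
  have hp1 : p + S p = 1 := by
    rw [hSp]; linear_combination huI + I u * hsum
  have hp2 : p * S p = 0 := by
    rw [hSp]; linear_combination I u ^ 2 * (hprod - I r * hsum + hrI)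
  -- This element is `b` on one factor and 1 on the other. `S` swaps the factors, so the product
  -- with its image is `b` on both.
  refine ⟨p * b ⊗ₜ 1 + S p, ?_⟩
  have hSb : S (b ⊗ₜ 1) = b ⊗ₜ 1 := by simp [S, hb]
  rw [hS, map_add, map_mul, hSS, hSb]
  generalize (b ⊗ₜ 1 : E ⊗[K] Ω) = c
  linear_combination (c ^ 2 + 1 - 2 * c) * hp2 + c * (p + S p + 1) * hp1

end HermitianSquare

/-! ### Unitary elements and the Galois action -/

section UnitaryElements

variable {K B Ω : Type*} [Field K] [Ring B] [Algebra K B] [Field Ω] [Algebra K Ω]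

namespace AlgInvolution

/-- Expand `τ(uv⁻¹)uv⁻¹ = τ(v)⁻¹ (τ(u)u) v⁻¹`. All later unitarity checks become comparisons of
hermitian squares. -/
theorem mul_inv_mem_unitaryGroup_iff (τ : AlgInvolution K B) (u v : (B ⊗[K] Ω)ˣ) :
    u * v⁻¹ ∈ τ.unitaryGroup Ω ↔ τ.baseChange Ω (u : B ⊗[K] Ω) * (u : B ⊗[K] Ω) =
      τ.baseChange Ω (v : B ⊗[K] Ω) * (v : B ⊗[K] Ω) := by
  change τ.baseChange Ω ((u : B ⊗[K] Ω) * ((v⁻¹ : (B ⊗[K] Ω)ˣ) : B ⊗[K] Ω)) *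
    ((u : B ⊗[K] Ω) * ((v⁻¹ : (B ⊗[K] Ω)ˣ) : B ⊗[K] Ω)) = 1 ↔ _
  have h1 : τ.baseChange Ω (v : B ⊗[K] Ω) *
      τ.baseChange Ω ((v⁻¹ : (B ⊗[K] Ω)ˣ) : B ⊗[K] Ω) = 1 := by
    rw [← map_mul_rev, Units.inv_mul, map_one]
  have h2 : τ.baseChange Ω ((v⁻¹ : (B ⊗[K] Ω)ˣ) : B ⊗[K] Ω) *
      τ.baseChange Ω (v : B ⊗[K] Ω) = 1 := by
    rw [← map_mul_rev, Units.mul_inv, map_one]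
  rw [map_mul_rev]
  constructor
  · intro h
    have := congrArg (fun x => τ.baseChange Ω (v : B ⊗[K] Ω) * x * (v : B ⊗[K] Ω)) h
    simp only [mul_one, ← mul_assoc, h1, one_mul] at this
    simpa [mul_assoc] using this
  · intro h
    rw [mul_assoc, ← mul_assoc _ (u : B ⊗[K] Ω), h, mul_assoc, Units.mul_inv, mul_one, h2]

theorem baseChange_galMap (τ : AlgInvolution K B) (θ : Ω ≃ₐ[K] Ω) (x : B ⊗[K] Ω) :
    τ.baseChange Ω (galMap B θ x) = galMap B θ (τ.baseChange Ω x) := by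
  rw [baseChange_apply, baseChange_apply]
  induction x with
  | zero => simp
  | add x y hx hy => simp only [map_add, hx, hy]
  | tmul b r => simp

theorem isUnit_apply (τ : AlgInvolution K B) (u : Bˣ) : IsUnit (τ (u : B)) :=
  ⟨⟨τ (u : B), τ ((u⁻¹ : Bˣ) : B), by rw [← τ.map_mul_rev, Units.inv_mul, τ.map_one],
    by rw [← τ.map_mul_rev, Units.mul_inv, τ.map_one]⟩, rfl⟩

theorem exists_unit_fixedSubalgebra {E : Type*} [CommRing E] [Algebra K E]
    (σ : AlgInvolution K E) {b : E} (hb : IsUnit b) (hσ : σ b = b) :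
    ∃ u : (σ.fixedSubalgebra)ˣ, ((u : σ.fixedSubalgebra) : E) = b := by
  obtain ⟨u, rfl⟩ := hb
  have hinv : σ ((u⁻¹ : Eˣ) : E) = ((u⁻¹ : Eˣ) : E) := by
    refine Units.eq_inv_of_mul_eq_one_left (u := u) ?_
    conv_lhs => rw [← hσ]
    rw [← σ.map_mul_rev, Units.inv_mul, σ.map_one]
  exact ⟨⟨⟨u, hσ⟩, ⟨((u⁻¹ : Eˣ) : E), hinv⟩, Subtype.ext u.mul_inv, Subtype.ext u.inv_mul⟩, rfl⟩

end AlgInvolution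

theorem galUnits_tmul_one (θ : Ω ≃ₐ[K] Ω) {u : (B ⊗[K] Ω)ˣ} {b : B}
    (hu : (u : B ⊗[K] Ω) = b ⊗ₜ 1) : galUnits B θ u = u := by
  ext
  change galMap B θ u = u
  rw [hu]
  simp

theorem galUnits_unitsBaseChange {E : Type*} [Ring E] [Algebra K E] (f : E →ₐ[K] B)
    (θ : Ω ≃ₐ[K] Ω) (x : (E ⊗[K] Ω)ˣ) :
    galUnits B θ (unitsBaseChange f Ω x) = unitsBaseChange f Ω (galUnits E θ x) := by
  ext
  change galMap B θ (Algebra.TensorProduct.map f (AlgHom.id K Ω) x) =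
    Algebra.TensorProduct.map f (AlgHom.id K Ω) (galMap E θ x)
  generalize (x : E ⊗[K] Ω) = x
  induction x with
  | zero => simp
  | add x y hx hy => simp only [map_add, hx, hy]
  | tmul b r => simp

end UnitaryElements

/-! ### Twisted cocycles and the equation g ε(b) = τ(h)h -/

section TwistedEmbedding

variable {K A E Ω : Type*} [Field K] [Ring A] [Algebra K A] [CommRing E] [Algebra K E]
  [Field Ω] [Algebra K Ω] (τ : AlgInvolution K A) (σ : AlgInvolution K E) (ε : E →ₐ[K] A) (g : Aˣ)
  (s : (A ⊗[K] Ω)ˣ)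

/-- The hermitian square of `s ε(x)` is `g ε(σ(x) x)`. -/
theorem baseChange_mul_self_twist
    (hgε : ∀ x : E, ε (σ x) = ((g⁻¹ : Aˣ) : A) * τ (ε x) * (g : A))
    (hs : (g : A) ⊗ₜ[K] (1 : Ω) = τ.baseChange Ω (s : A ⊗[K] Ω) * (s : A ⊗[K] Ω))
    (x : (E ⊗[K] Ω)ˣ) :
    τ.baseChange Ω ((s * unitsBaseChange ε Ω x : (A ⊗[K] Ω)ˣ) : A ⊗[K] Ω) *
        ((s * unitsBaseChange ε Ω x : (A ⊗[K] Ω)ˣ) : A ⊗[K] Ω) =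
      (g : A) ⊗ₜ[K] (1 : Ω) * Algebra.TensorProduct.map ε (AlgHom.id K Ω)
        (σ.baseChange Ω (x : E ⊗[K] Ω) * x) := by
  change τ.baseChange Ω (s * Algebra.TensorProduct.map ε (AlgHom.id K Ω) x) *
    (s * Algebra.TensorProduct.map ε (AlgHom.id K Ω) x) = _
  have h (z : E ⊗[K] Ω) : τ.baseChange Ω (Algebra.TensorProduct.map ε (AlgHom.id K Ω) z) *
      (g : A) ⊗ₜ[K] (1 : Ω) = (g : A) ⊗ₜ[K] (1 : Ω) *
        Algebra.TensorProduct.map ε (AlgHom.id K Ω) (σ.baseChange Ω z) := by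
    rw [AlgInvolution.baseChange_apply, AlgInvolution.baseChange_apply]
    induction z with
    | zero => simp
    | add x y hx hy => simp only [map_add, add_mul, mul_add, hx, hy]
    | tmul b r => simp [hgε, mul_assoc]
  rw [τ.baseChange Ω |>.map_mul_rev, mul_assoc, ← mul_assoc _ (s : A ⊗[K] Ω), ← hs, ← mul_assoc, h,
    mul_assoc, ← map_mul]

theorem twist_mul_inv_mem_unitaryGroup
    (hgε : ∀ x : E, ε (σ x) = ((g⁻¹ : Aˣ) : A) * τ (ε x) * (g : A))
    (hs : (g : A) ⊗ₜ[K] (1 : Ω) = τ.baseChange Ω (s : A ⊗[K] Ω) * (s : A ⊗[K] Ω))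
    {x : (E ⊗[K] Ω)ˣ} (hx : x ∈ σ.unitaryGroup Ω) (θ : Ω ≃ₐ[K] Ω) :
    s * unitsBaseChange ε Ω x * (galUnits A θ s)⁻¹ ∈ τ.unitaryGroup Ω := by
  have hx' : σ.baseChange Ω (x : E ⊗[K] Ω) * x = 1 := hx
  rw [τ.mul_inv_mem_unitaryGroup_iff, baseChange_mul_self_twist τ σ ε g s hgε hs, hx', map_one,
    mul_one]
  change _ = τ.baseChange Ω (galMap A θ s) * galMap A θ s
  rw [τ.baseChange_galMap, ← map_mul, ← hs]
  simp

/-- The inner factors `θ₁(s)⁻¹ θ₁(s)` cancel in the cocycle identity, since `ε` commutes with the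
Galois action; continuity holds because `θ ↦ θ(s)` is locally constant. -/
theorem exists_twisted_cocycle [Algebra.IsAlgebraic K Ω]
    (hgε : ∀ x : E, ε (σ x) = ((g⁻¹ : Aˣ) : A) * τ (ε x) * (g : A))
    (hs : (g : A) ⊗ₜ[K] (1 : Ω) = τ.baseChange Ω (s : A ⊗[K] Ω) * (s : A ⊗[K] Ω))
    (ξ : UnitaryZ1 σ Ω) : ∃ ζ : UnitaryZ1 τ Ω, ∀ θ : Ω ≃ₐ[K] Ω,
      ((ζ θ : τ.unitaryGroup Ω) : (A ⊗[K] Ω)ˣ) =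
        s * unitsBaseChange ε Ω (ξ θ : (E ⊗[K] Ω)ˣ) * (galUnits A θ s)⁻¹ := by
  refine ⟨⟨fun θ => ⟨_, twist_mul_inv_mem_unitaryGroup τ σ ε g s hgε hs (ξ θ).2 θ⟩, ?_, ?_⟩,
    fun _ => rfl⟩
  · refine IsLocallyConstant.desc _ Subtype.val ?_ Subtype.val_injective
    exact (ξ.locConst'.comp fun x => s * unitsBaseChange ε Ω (x : (E ⊗[K] Ω)ˣ)).mul
      (isLocallyConstant_galUnits s).inv
  · intro θ₁ θ₂
    refine Subtype.ext ?_
    have h : ((ξ (θ₁ * θ₂) : σ.unitaryGroup Ω) : (E ⊗[K] Ω)ˣ) =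
        (ξ θ₁ : (E ⊗[K] Ω)ˣ) * galUnits E θ₁ (ξ θ₂ : (E ⊗[K] Ω)ˣ) :=
      congrArg Subtype.val (ξ.map_mul' θ₁ θ₂)
    change s * unitsBaseChange ε Ω (ξ (θ₁ * θ₂) : (E ⊗[K] Ω)ˣ) * (galUnits A (θ₁ * θ₂) s)⁻¹ =
      s * unitsBaseChange ε Ω (ξ θ₁ : (E ⊗[K] Ω)ˣ) * (galUnits A θ₁ s)⁻¹ *
        galUnits A θ₁ (s * unitsBaseChange ε Ω (ξ θ₂ : (E ⊗[K] Ω)ˣ) * (galUnits A θ₂ s)⁻¹)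
    rw [h, galUnits_mul]
    simp only [map_mul, map_inv, galUnits_unitsBaseChange]
    group

theorem twisted_cocycle_cls_eq
    (hgε : ∀ x : E, ε (σ x) = ((g⁻¹ : Aˣ) : A) * τ (ε x) * (g : A))
    (hs : (g : A) ⊗ₜ[K] (1 : Ω) = τ.baseChange Ω (s : A ⊗[K] Ω) * (s : A ⊗[K] Ω))
    {ξ ξ' : UnitaryZ1 σ Ω} {ζ ζ' : UnitaryZ1 τ Ω}
    (hζ : ∀ θ : Ω ≃ₐ[K] Ω, ((ζ θ : τ.unitaryGroup Ω) : (A ⊗[K] Ω)ˣ) =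
      s * unitsBaseChange ε Ω (ξ θ : (E ⊗[K] Ω)ˣ) * (galUnits A θ s)⁻¹)
    (hζ' : ∀ θ : Ω ≃ₐ[K] Ω, ((ζ' θ : τ.unitaryGroup Ω) : (A ⊗[K] Ω)ˣ) =
      s * unitsBaseChange ε Ω (ξ' θ : (E ⊗[K] Ω)ˣ) * (galUnits A θ s)⁻¹)
    (h : ∃ t : σ.unitaryGroup Ω, ∀ θ : Ω ≃ₐ[K] Ω, ξ' θ = t * ξ θ * (θ • t)⁻¹) :
    ζ.cls = ζ'.cls := by
  obtain ⟨t, ht⟩ := h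
  -- The case `θ = 1` says that `s ε(t) s⁻¹` is unitary; it carries `ζ` to `ζ'`.
  have hmem := twist_mul_inv_mem_unitaryGroup τ σ ε g s hgε hs t.2 1
  rw [galUnits_one] at hmem
  refine Quotient.sound ⟨⟨_, hmem⟩, fun θ => Subtype.ext ?_⟩
  have h : ((ξ' θ : σ.unitaryGroup Ω) : (E ⊗[K] Ω)ˣ) =
      (t : (E ⊗[K] Ω)ˣ) * (ξ θ : (E ⊗[K] Ω)ˣ) * (galUnits E θ (t : (E ⊗[K] Ω)ˣ))⁻¹ :=
    congrArg Subtype.val (ht θ)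
  change ((ζ' θ : τ.unitaryGroup Ω) : (A ⊗[K] Ω)ˣ) =
    s * unitsBaseChange ε Ω (t : (E ⊗[K] Ω)ˣ) * s⁻¹ * ((ζ θ : τ.unitaryGroup Ω) : (A ⊗[K] Ω)ˣ) *
      (galUnits A θ (s * unitsBaseChange ε Ω (t : (E ⊗[K] Ω)ˣ) * s⁻¹))⁻¹
  rw [hζ', hζ, h]
  simp only [map_mul, map_inv, galUnits_unitsBaseChange]
  group

/-- A solution of `g ε(b) = τ(h) h` trivializes a twisted cocycle. -/
theorem exists_cocycle_of_hermitian_solution [Algebra.IsAlgebraic K Ω]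
    (hgε : ∀ x : E, ε (σ x) = ((g⁻¹ : Aˣ) : A) * τ (ε x) * (g : A))
    (hs : (g : A) ⊗ₜ[K] (1 : Ω) = τ.baseChange Ω (s : A ⊗[K] Ω) * (s : A ⊗[K] Ω))
    {b : E} {h : Aˣ} (hbh : (g : A) * ε b = τ (h : A) * (h : A)) {e : (E ⊗[K] Ω)ˣ}
    (he : σ.baseChange Ω (e : E ⊗[K] Ω) * (e : E ⊗[K] Ω) = b ⊗ₜ 1) :
    ∃ ξ : UnitaryZ1 σ Ω, ∃ t : τ.unitaryGroup Ω, ∀ θ : Ω ≃ₐ[K] Ω,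
      s * unitsBaseChange ε Ω (ξ θ : (E ⊗[K] Ω)ˣ) * (galUnits A θ s)⁻¹ =
        (t : (A ⊗[K] Ω)ˣ) * (galUnits A θ (t : (A ⊗[K] Ω)ˣ))⁻¹ := by
  -- `e` and `θ(e)` have the same hermitian square because `b ⊗ 1` is Galois-fixed.
  have hmem (θ : Ω ≃ₐ[K] Ω) : e * (galUnits E θ e)⁻¹ ∈ σ.unitaryGroup Ω := by
    rw [σ.mul_inv_mem_unitaryGroup_iff]
    change _ = σ.baseChange Ω (galMap E θ e) * galMap E θ e
    rw [σ.baseChange_galMap, ← map_mul, he]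
    simp
  let h' : (A ⊗[K] Ω)ˣ :=
    Units.map (Algebra.TensorProduct.includeLeft : A →ₐ[K] A ⊗[K] Ω).toMonoidHom h
  have hh' : (h' : A ⊗[K] Ω) = (h : A) ⊗ₜ 1 := rfl
  have ht : s * unitsBaseChange ε Ω e * h'⁻¹ ∈ τ.unitaryGroup Ω := by
    rw [τ.mul_inv_mem_unitaryGroup_iff, baseChange_mul_self_twist τ σ ε g s hgε hs, he, hh',
      AlgInvolution.baseChange_apply]
    simp [hbh]
  refine ⟨⟨fun θ => ⟨_, hmem θ⟩, ?_, fun θ₁ θ₂ => Subtype.ext ?_⟩, ⟨_, ht⟩, fun θ => ?_⟩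
  · refine IsLocallyConstant.desc _ Subtype.val ?_ Subtype.val_injective
    exact (IsLocallyConstant.const e).mul (isLocallyConstant_galUnits e).inv
  · change e * (galUnits E (θ₁ * θ₂) e)⁻¹ =
      e * (galUnits E θ₁ e)⁻¹ * galUnits E θ₁ (e * (galUnits E θ₂ e)⁻¹)
    rw [galUnits_mul, map_mul, map_inv]
    group
  · change s * unitsBaseChange ε Ω (e * (galUnits E θ e)⁻¹) * (galUnits A θ s)⁻¹ =
      s * unitsBaseChange ε Ω e * h'⁻¹ * (galUnits A θ (s * unitsBaseChange ε Ω e * h'⁻¹))⁻¹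
    simp only [map_mul, map_inv, galUnits_unitsBaseChange, galUnits_tmul_one θ hh']
    group

/-- If a twisted cocycle is trivial, then `g ε(b) = τ(h) h` has a solution. -/
theorem exists_hermitian_solution_of_cocycle [IsGalois K Ω] [FiniteDimensional K A]
    [FiniteDimensional K E] [IsReduced E] (hε : Function.Injective ε)
    (hgε : ∀ x : E, ε (σ x) = ((g⁻¹ : Aˣ) : A) * τ (ε x) * (g : A))
    (hs : (g : A) ⊗ₜ[K] (1 : Ω) = τ.baseChange Ω (s : A ⊗[K] Ω) * (s : A ⊗[K] Ω))
    (ξ : UnitaryZ1 σ Ω) (t : τ.unitaryGroup Ω) (hξ : ∀ θ : Ω ≃ₐ[K] Ω,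
      s * unitsBaseChange ε Ω (ξ θ : (E ⊗[K] Ω)ˣ) * (galUnits A θ s)⁻¹ =
        (t : (A ⊗[K] Ω)ˣ) * (galUnits A θ (t : (A ⊗[K] Ω)ˣ))⁻¹) :
    ∃ (b : (σ.fixedSubalgebra)ˣ) (h : Aˣ),
      (g : A) * ε ((b : σ.fixedSubalgebra) : E) = τ (h : A) * (h : A) := by
  -- Triviality of the twist reads `θ(t⁻¹s) = t⁻¹s ε(ξ_θ)`, which is the Galois-stability of the
  -- coset.
  obtain ⟨h, e, he⟩ := exists_unit_eq_mul_of_galois_stable ε hε ((t : (A ⊗[K] Ω)ˣ)⁻¹ * s)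
    fun θ => by
      refine ⟨(ξ θ : (E ⊗[K] Ω)ˣ), ?_⟩
      suffices H : galUnits A θ ((t : (A ⊗[K] Ω)ˣ)⁻¹ * s) =
          (t : (A ⊗[K] Ω)ˣ)⁻¹ * s * unitsBaseChange ε Ω (ξ θ : (E ⊗[K] Ω)ˣ) from
        congrArg Units.val H
      have := hξ θ
      rw [mul_inv_eq_iff_eq_mul] at this
      rw [mul_assoc, this, map_mul, map_inv]
      group
  set F : E ⊗[K] Ω →ₐ[K] A ⊗[K] Ω := Algebra.TensorProduct.map ε (AlgHom.id K Ω)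
  have hF : Function.Injective F :=
    Module.Flat.rTensor_preserves_injective_linearMap ε.toLinearMap hε
  have hFg (θ : Ω ≃ₐ[K] Ω) (z : E ⊗[K] Ω) : galMap A θ (F z) = F (galMap E θ z) := by
    induction z with
    | zero => simp
    | add x y hx hy => simp only [map_add, hx, hy]
    | tmul b r => simp [F]
  have he' : ((s * unitsBaseChange ε Ω e : (A ⊗[K] Ω)ˣ) : A ⊗[K] Ω) =
      ((t : (A ⊗[K] Ω)ˣ) : A ⊗[K] Ω) * (h : A) ⊗ₜ[K] (1 : Ω) := by
    rw [he, Units.val_mul, Units.val_mul, mul_assoc, Units.mul_inv_cancel_left]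
    rfl
  set c := σ.baseChange Ω (e : E ⊗[K] Ω) * e with hc
  have hgF : (g : A) ⊗ₜ[K] (1 : Ω) * F c = (τ (h : A) * (h : A)) ⊗ₜ[K] (1 : Ω) := by
    rw [← baseChange_mul_self_twist τ σ ε g s hgε hs, he', (τ.baseChange Ω).map_mul_rev]
    have ht : τ.baseChange Ω ((t : (A ⊗[K] Ω)ˣ) : A ⊗[K] Ω) * ((t : (A ⊗[K] Ω)ˣ) : A ⊗[K] Ω) = 1 :=
      t.2
    rw [mul_assoc, ← mul_assoc _ ((t : (A ⊗[K] Ω)ˣ) : A ⊗[K] Ω), ht, one_mul,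
      AlgInvolution.baseChange_apply]
    simp
  have hFc : F c = (((g⁻¹ : Aˣ) : A) * (τ (h : A) * (h : A))) ⊗ₜ[K] (1 : Ω) := by
    have := congrArg (((g⁻¹ : Aˣ) : A) ⊗ₜ[K] (1 : Ω) * ·) hgF
    simp only [← mul_assoc, Algebra.TensorProduct.tmul_mul_tmul, Units.inv_mul, mul_one] at this
    rw [← Algebra.TensorProduct.one_def, one_mul] at this
    rw [this, mul_assoc]
  -- The image of `c` is `g⁻¹ τ(h)h ⊗ 1`, so it is Galois-fixed, and `F` is injective and
  -- equivariant.
  obtain ⟨b, hb⟩ : ∃ b : E, c = b ⊗ₜ 1 := exists_eq_tmul_one_of_galMap_eq fun θ => hF <| by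
    rw [← hFg, hFc]
    simp
  have hσb : σ b = b := by
    refine tmul_one_injective (k := K) (S := Ω) ?_
    change σ.baseChange Ω (b ⊗ₜ[K] (1 : Ω)) = b ⊗ₜ[K] (1 : Ω)
    rw [← hb, hc, (σ.baseChange Ω).map_mul_rev, (σ.baseChange Ω).apply_apply]
  have hbu : IsUnit b := by
    refine isUnit_of_isUnit_tmul_one (k := K) (Ω := Ω) ?_
    rw [← hb, hc]
    exact (e.isUnit.map (Algebra.TensorProduct.map σ.toAlgHom (AlgHom.id K Ω))).mul e.isUnit
  obtain ⟨u, hu⟩ := σ.exists_unit_fixedSubalgebra hbu hσb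
  refine ⟨u, h, tmul_one_injective (k := K) (S := Ω) ?_⟩
  change ((g : A) * ε _) ⊗ₜ[K] (1 : Ω) = (τ (h : A) * (h : A)) ⊗ₜ[K] (1 : Ω)
  rw [← hgF, hb, hu]
  simp [F]

end TwistedEmbedding

/-! ### Embeddings compatible with the involutions -/

section InvolutiveEmbeddings

variable {K A E : Type*} [Field K] [Ring A] [Algebra K A] [CommRing E] [Algebra K E]

/-- A solution of `g ε(b) = τ(h) h` makes a conjugate of `ε` compatible with the involutions. -/
theorem conj_comm_involution (τ : AlgInvolution K A) (σ : AlgInvolution K E) (ε : E →ₐ[K] A)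
    (g : Aˣ) (hgε : ∀ x : E, ε (σ x) = ((g⁻¹ : Aˣ) : A) * τ (ε x) * (g : A)) {b : E} {h : Aˣ}
    (hbh : (g : A) * ε b = τ (h : A) * (h : A)) (x : E) :
    (h : A) * ε (σ x) * ((h⁻¹ : Aˣ) : A) = τ ((h : A) * ε x * ((h⁻¹ : Aˣ) : A)) := by
  have hτ : τ ((h⁻¹ : Aˣ) : A) * τ (h : A) = 1 := by
    rw [← τ.map_mul_rev, Units.mul_inv, τ.map_one]
  have hgx : (g : A) * ε (σ x) = τ (ε x) * g := by rw [hgε]; simp [← mul_assoc]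
  have hcomm : ε (σ x) * ε b = ε b * ε (σ x) := by rw [← map_mul, ← map_mul, mul_comm]
  have key : τ (h : A) * ((h : A) * ε (σ x)) = τ (ε x) * τ (h : A) * h := by
    rw [← mul_assoc, ← hbh, mul_assoc, ← hcomm, ← mul_assoc, hgx, mul_assoc, hbh, mul_assoc]
  rw [Units.mul_inv_eq_iff_eq_mul, τ.map_mul_rev, τ.map_mul_rev, mul_assoc, ← key, ← mul_assoc, hτ,
    one_mul]

/-- If a conjugate of `ε` is compatible with the involutions, then `g⁻¹ τ(h) h` commutes with the
image of `ε`. -/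
theorem commute_of_conj_comm_involution (τ : AlgInvolution K A) (σ : AlgInvolution K E)
    (ε : E →ₐ[K] A) (g : Aˣ)
    (hgε : ∀ x : E, ε (σ x) = ((g⁻¹ : Aˣ) : A) * τ (ε x) * (g : A)) {i : E → A}
    (hi : ∀ x, i (σ x) = τ (i x)) {h : Aˣ} (hh : ∀ x, i x * h = h * ε x) (x : E) :
    ε x * (((g⁻¹ : Aˣ) : A) * (τ (h : A) * (h : A))) =
      ((g⁻¹ : Aˣ) : A) * (τ (h : A) * (h : A)) * ε x := by
  have h1 := congrArg τ.toLinearMap (hh (σ x))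
  have h1' : τ (i (σ x) * h) = τ (h * ε (σ x)) := h1
  rw [τ.map_mul_rev, τ.map_mul_rev, hi, τ.apply_apply] at h1'
  have h2 : ε x * ((g⁻¹ : Aˣ) : A) = ((g⁻¹ : Aˣ) : A) * τ (ε (σ x)) := by
    have := hgε (σ x)
    rw [σ.apply_apply] at this
    rw [this, Units.mul_inv_cancel_right]
  rw [← mul_assoc, h2, mul_assoc, ← mul_assoc (τ (ε (σ x))), ← h1', mul_assoc (τ (h : A)), hh]
  simp only [mul_assoc]

/-- Both `g` and `τ(h)h` are `τ`-symmetric, so `τ(ε(b)) g = g ε(b)`, and hence `ε(σ(b)) = ε(b)`. -/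
theorem fixed_of_hermitian_solution (τ : AlgInvolution K A) (σ : AlgInvolution K E)
    (ε : E →ₐ[K] A) (hε : Function.Injective ε) (g : Aˣ) (hg : τ (g : A) = g)
    (hgε : ∀ x : E, ε (σ x) = ((g⁻¹ : Aˣ) : A) * τ (ε x) * (g : A)) {b : E} {h : Aˣ}
    (hbh : (g : A) * ε b = τ (h : A) * (h : A)) : σ b = b := by
  apply hε
  have h1 : τ ((g : A) * ε b) = (g : A) * ε b := by
    rw [hbh, τ.map_mul_rev, τ.apply_apply]
  rw [τ.map_mul_rev, hg] at h1
  rw [hgε, mul_assoc, h1, Units.inv_mul_cancel_left]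

end InvolutiveEmbeddings

/-! ### The involution on the centre -/

section CentreInvolution

variable {K L : Type*} [Field K] [Field L] [Algebra K L]

/-- A field is finite over the fixed field of an involution. -/
theorem finiteDimensional_of_involution (ι : L ≃ₐ[K] L) (hι : ∀ l, ι (ι l) = l)
    (hK : ∀ l : L, ι l = l → l ∈ Set.range (algebraMap K L)) : FiniteDimensional K L := by
  by_cases h : ∀ l, ι l = l
  · exact Module.Finite.of_surjective (Algebra.linearMap K L) fun l => hK l (h l)
  push Not at h
  obtain ⟨α, hα⟩ := h
  have hα' : ι α - α ≠ 0 := sub_ne_zero.2 hα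
  refine ⟨Submodule.fg_def.2 ⟨{1, α}, Set.toFinite _, top_le_iff.1 fun l _ => ?_⟩⟩
  -- The coefficient of `α` in the basis `1, α`: numerator and denominator both change sign under
  -- `ι`, so the quotient lies in `K`.
  obtain ⟨c, hc⟩ := hK ((ι l - l) / (ι α - α)) (by
    rw [map_div₀, map_sub, map_sub, hι, hι, ← neg_sub, ← neg_sub (ι α), neg_div_neg_eq])
  obtain ⟨d, hd⟩ := hK (l - algebraMap K L c * α) (by
    rw [map_sub, map_mul, AlgEquiv.commutes]
    rw [eq_div_iff hα'] at hc
    linear_combination -hc)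
  have : l = d • 1 + c • α := by
    rw [Algebra.smul_def, Algebra.smul_def, hd]; ring
  rw [this]
  exact add_mem (Submodule.smul_mem _ _ (Submodule.subset_span (by simp)))
    (Submodule.smul_mem _ _ (Submodule.subset_span (by simp)))

/-- Over the separable closure, every element fixed by `σ` is of the form `σ(e) e`. -/
theorem exists_baseChange_mul_self {E Ω : Type*} [CommRing E] [Algebra L E] [Algebra K E]
    [IsScalarTower K L E] [Algebra.Etale L E] [Field Ω] [Algebra K Ω] [IsSepClosed Ω]
    (σ : AlgInvolution K E) (ι : L ≃ₐ[K] L) (hι : ∀ l, ι (ι l) = l)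
    (hσ : ∀ l : L, σ (algebraMap L E l) = algebraMap L E (ι l))
    (hK : ∀ l : L, ι l = l → l ∈ Set.range (algebraMap K L))
    (hkind : ι ≠ AlgEquiv.refl ∨ (ι = AlgEquiv.refl ∧ (2 : L) ≠ 0)) {b : E} (hb : σ b = b) :
    ∃ e : E ⊗[K] Ω, σ.baseChange Ω e * e = b ⊗ₜ 1 := by
  rcases hkind with h | ⟨rfl, h2⟩
  · obtain ⟨α, hα⟩ : ∃ α, α ≠ ι α := by
      by_contra! h'
      exact h (AlgEquiv.ext fun l => (h' l).symm)
    obtain ⟨t, ht⟩ := hK (α + ι α) (by rw [map_add, hι, add_comm])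
    obtain ⟨d, hd⟩ := hK (α * ι α) (by rw [map_mul, hι, mul_comm])
    exact exists_baseChange_mul_self_of_quadratic σ hα (hσ α) ht hd hb
  · have : Algebra.Etale K L := Algebra.Etale.of_equiv
      (AlgEquiv.ofBijective (Algebra.ofId K L) ⟨(algebraMap K L).injective, fun l => hK l rfl⟩)
    have : Algebra.Etale K E := Algebra.Etale.comp K L E
    refine exists_baseChange_mul_self_of_two_ne_zero ?_ σ hb
    intro h
    exact h2 (by rw [← map_ofNat (algebraMap K L) 2, h, map_zero])

end CentreInvolution

/-- The clause over all `ξ` determines `φ`: every class has a representative, and the formula fixes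
`ζ`. -/
theorem propositionA
    {K L A E Ks : Type*} [Field K] [Field L] [Algebra K L]
    [Ring A] [Algebra L A] [Algebra K A] [IsScalarTower K L A]
    [Algebra.IsCentral L A] [IsSimpleRing A] [FiniteDimensional L A]
    [CommRing E] [Algebra L E] [Algebra K E] [IsScalarTower K L E] [Algebra.Etale L E]
    [Field Ks] [Algebra K Ks] [IsSepClosure K Ks]
    (n : ℕ) (hA : Module.finrank L A = n ^ 2) (hE : Module.finrank L E = n)
    (τ : AlgInvolution K A) (σ : AlgInvolution K E)
    -- `ι` is the common restriction of `τ` and `σ` to `L`, and `K` is its fixed field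
    (ι : L ≃ₐ[K] L)
    (hτ : ∀ l : L, τ (algebraMap L A l) = algebraMap L A (ι l))
    (hσ : ∀ l : L, σ (algebraMap L E l) = algebraMap L E (ι l))
    (hK : ∀ l : L, ι l = l → l ∈ Set.range (algebraMap K L))
    -- `τ` is of the second kind, or of the first kind with the usual conditions
    (hkind : ι ≠ AlgEquiv.refl ∨
      (ι = AlgEquiv.refl ∧ (2 : L) ≠ 0 ∧ Even n ∧ Module.finrank K σ.fixedSubalgebra = n / 2))
    (ε : E →ₐ[L] A) (hε : Function.Injective ε)
    (g : Aˣ) (hg : τ (g : A) = g)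
    (hgε : ∀ x : E, ε (σ x) = ((g⁻¹ : Aˣ) : A) * τ (ε x) * (g : A))
    (s : (A ⊗[K] Ks)ˣ)
    (hs : (g : A) ⊗ₜ[K] (1 : Ks) = τ.baseChange Ks (s : A ⊗[K] Ks) * (s : A ⊗[K] Ks)) :
    ∃ φ : UnitaryH1 σ Ks → UnitaryH1 τ Ks,
      (∀ ξ : UnitaryZ1 σ Ks, ∃ ζ : UnitaryZ1 τ Ks,
        (∀ θ : Ks ≃ₐ[K] Ks, ((ζ θ : τ.unitaryGroup Ks) : (A ⊗[K] Ks)ˣ) =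
          s * unitsBaseChange (ε.restrictScalars K) Ks (ξ θ : (E ⊗[K] Ks)ˣ) *
            (galUnits A θ s)⁻¹) ∧
        φ ξ.cls = ζ.cls) ∧
      ((∃ (b : (σ.fixedSubalgebra)ˣ) (h : Aˣ),
          (g : A) * ε ((b : σ.fixedSubalgebra) : E) = τ (h : A) * (h : A)) ↔
        ContH1.trivialClass (Ks ≃ₐ[K] Ks) (τ.unitaryGroup Ks) ∈ Set.range φ) ∧
      ((∃ (b : (σ.fixedSubalgebra)ˣ) (h : Aˣ),
          (g : A) * ε ((b : σ.fixedSubalgebra) : E) = τ (h : A) * (h : A)) ↔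
        ∃ i : E →ₐ[L] A, Function.Injective i ∧ ∀ x : E, i (σ x) = τ (i x)) := by
  have : Nontrivial E := by
    have : Nontrivial A := inferInstance
    have hn : n ≠ 0 := by
      rintro rfl
      exact (Module.finrank_pos (R := L) (M := A)).ne' (by simpa using hA)
    exact Module.nontrivial_of_finrank_pos (R := L) (by omega)
  have : FiniteDimensional L E := Algebra.Etale.finiteDimensional
  have : IsReduced E := Algebra.FormallyUnramified.isReduced_of_field L E
  have hι (l : L) : ι (ι l) = l := by
    apply (algebraMap L A).injective
    rw [← hτ, ← hτ, τ.apply_apply]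
  have : FiniteDimensional K L := finiteDimensional_of_involution ι hι hK
  have : FiniteDimensional K A := Module.Finite.trans L A
  have : FiniteDimensional K E := Module.Finite.trans L E
  have : IsSepClosed Ks := IsSepClosure.sep_closed K
  have : IsGalois K Ks := inferInstance
  have hgε' : ∀ x : E, (ε.restrictScalars K) (σ x) =
      ((g⁻¹ : Aˣ) : A) * τ ((ε.restrictScalars K) x) * (g : A) := hgε
  choose Φ hΦ using fun ξ => exists_twisted_cocycle τ σ (ε.restrictScalars K) g s hgε' hs ξ
  let φ : UnitaryH1 σ Ks → UnitaryH1 τ Ks := Quotient.lift (fun ξ => (Φ ξ).cls) fun ξ ξ' h =>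
    twisted_cocycle_cls_eq τ σ (ε.restrictScalars K) g s hgε' hs (hΦ ξ) (hΦ ξ') h
  refine ⟨φ, fun ξ => ⟨Φ ξ, hΦ ξ, rfl⟩, ⟨?_, ?_⟩, ⟨?_, ?_⟩⟩
  · rintro ⟨b, h, hbh⟩
    obtain ⟨e, he⟩ := exists_baseChange_mul_self (Ω := Ks) σ ι hι hσ hK
      (hkind.imp_right fun h => ⟨h.1, h.2.1⟩) (b : σ.fixedSubalgebra).2
    have hbu : IsUnit (((b : σ.fixedSubalgebra) : E) ⊗ₜ[K] (1 : Ks)) :=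
      (b.isUnit.map σ.fixedSubalgebra.val).map
        (Algebra.TensorProduct.includeLeft : E →ₐ[K] E ⊗[K] Ks)
    rw [← he] at hbu
    -- `e` is invertible because it divides the unit `b ⊗ 1`.
    obtain ⟨e, rfl⟩ := isUnit_of_mul_isUnit_right hbu
    obtain ⟨ξ, t, hξ⟩ := exists_cocycle_of_hermitian_solution τ σ (ε.restrictScalars K) g s hgε' hs
      hbh he
    have hcls : ContH1.trivialClass (Ks ≃ₐ[K] Ks) (τ.unitaryGroup Ks) = (Φ ξ).cls := by
      refine Quotient.sound ⟨t, fun θ => Subtype.ext ?_⟩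
      rw [hΦ, hξ]
      change _ = (t : (A ⊗[K] Ks)ˣ) * 1 * (galUnits A θ (t : (A ⊗[K] Ks)ˣ))⁻¹
      rw [mul_one]
    exact ⟨ξ.cls, hcls.symm⟩
  · rintro ⟨x, hx⟩
    obtain ⟨ξ, rfl⟩ := Quotient.exists_rep x
    obtain ⟨t, ht⟩ := Quotient.exact hx.symm
    refine exists_hermitian_solution_of_cocycle τ σ (ε.restrictScalars K) g s hε hgε' hs ξ t
      fun θ => ?_
    rw [← hΦ, ht]
    change (t : (A ⊗[K] Ks)ˣ) * 1 * (galUnits A θ (t : (A ⊗[K] Ks)ˣ))⁻¹ = _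
    rw [mul_one]
  · rintro ⟨b, h, hbh⟩
    -- `ε` followed by conjugation by `h`, as an `L`-algebra map.
    let i : E →ₐ[L] A := (MulSemiringAction.toAlgEquiv L A (ConjAct.toConjAct h)).toAlgHom.comp ε
    have hi (x) : i x = (h : A) * ε x * ((h⁻¹ : Aˣ) : A) := rfl
    refine ⟨i, (MulSemiringAction.toAlgEquiv L A (ConjAct.toConjAct h)).injective.comp hε,
      fun x => ?_⟩
    rw [hi, hi]
    exact conj_comm_involution τ σ (ε.restrictScalars K) g hgε' hbh x
  · rintro ⟨i, hi, hiσ⟩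
    obtain ⟨h, hh⟩ := exists_conj_of_etale n hA hE ε i hε hi
    obtain ⟨b, hb⟩ := mem_range_of_commute n hA hE ε hε
      (commute_of_conj_comm_involution τ σ (ε.restrictScalars K) g hgε' hiσ hh)
    have hbh : (g : A) * ε b = τ (h : A) * (h : A) := by rw [hb, Units.mul_inv_cancel_left]
    have hbu : IsUnit b := by
      have hu : IsUnit (ε b) := by
        rw [hb]
        exact g⁻¹.isUnit.mul ((τ.isUnit_apply h).mul h.isUnit)
      refine isUnit_of_mul_left_injective (k := K) fun x hx => hε ?_
      rw [map_zero, ← hu.mul_right_eq_zero, ← map_mul, hx, map_zero]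
    obtain ⟨u, rfl⟩ := σ.exists_unit_fixedSubalgebra hbu
      (fixed_of_hermitian_solution τ σ (ε.restrictScalars K) hε g hg hgε' hbh)
    exact ⟨u, h, hbh⟩
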